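/- Let $d \ge 1$. Let $\mathcal{F}_d$ be the class of upper semicontinuous log-concave probability densities $f:\mathbb{R}^d \to [0,\infty)$ with respect to Lebesgue measure (log-concave meaning that $\log f:\mathbb{R}^d\to[-\infty,\infty)$ is concave, with $\log 0 := -\infty$), and let $\mathcal{P}_d$ be the class of probability measures $P$ on $\mathbb{R}^d$ with $\int \|x\| \, dP(x) < \infty$ and $P(H) < 1$ for every hyperplane $H$. For $P \in \mathcal{P}_d$ let \[ \psi^*(P) := \operatorname*{argmax}_{f \in \mathcal{F}_d} \int_{\mathbb{R}^d} \log f \, dP , \] and say that $\psi^*(Q)$ is well-defined if $Q \in \mathcal{P}_d$ and the maximiser over $\mathcal{F}_d$ exists and is unique. Let $X_1, X_2, \ldots$ be independent random vectors with common distribution $P \in \mathcal{P}_d$, and let $\mathbb{P}_n := n^{-1}\sum_{i=1}^n \delta_{X_i}$ be the empirical distribution. Then $f^* := \psi^*(P)$ is well-defined, there exist $\alpha_0 > 0$ and $\beta_0 \in \mathbb{R}$ with \[ f^*(x) \le e^{-\alpha_0\|x\|+\beta_0} \quad \text{for all } x \in \mathbb{R}^d, \qquad (*) \] and, with probability one,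 both of the following hold: $\hat f_n := \psi^*(\mathbb{P}_n)$ is well-defined for all sufficiently large $n$; and for all $\alpha_0 > 0$ and $\beta_0 \in \mathbb{R}$ satisfying $(*)$ and every real $\alpha < \alpha_0$, \[ \int_{\mathbb{R}^d} e^{\alpha\|x\|} \, |\hat f_n(x) - f^*(x)| \, dx \to 0 \quad \text{as } n \to \infty . \] -/

import Mathlib

open MeasureTheory ProbabilityTheory Filter Topology

namespace LogConcaveMLE

noncomputable section

/-- The logarithm of `f : ℝᵈ → [0,∞)`, as a function into `[-∞,∞)`, with `log 0 = -∞`. -/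
def logFun {d : ℕ} (f : EuclideanSpace ℝ (Fin d) → ℝ) (x : EuclideanSpace ℝ (Fin d)) : EReal :=
  ENNReal.log (ENNReal.ofReal (f x))

/-- Concavity of a function on `ℝᵈ` with values in `[-∞,∞)`. A positive multiple of `⊥ : EReal`
is `⊥`, and `⊥` plus anything is `⊥`. -/
def IsConcave {d : ℕ} (φ : EuclideanSpace ℝ (Fin d) → EReal) : Prop :=
  ∀ x y : EuclideanSpace ℝ (Fin d), ∀ a b : ℝ, 0 < a → 0 < b → a + b = 1 →
    (a : EReal) * φ x + (b : EReal) * φ y ≤ φ (a • x + b • y)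

/-- The class `𝓕_d` of upper semicontinuous log-concave densities on `ℝᵈ`. -/
structure IsLogConcaveDensity {d : ℕ} (f : EuclideanSpace ℝ (Fin d) → ℝ) : Prop where
  nonneg : ∀ x, 0 ≤ f x
  usc : UpperSemicontinuous f
  concave_log : IsConcave (logFun f)
  lintegral_eq_one : ∫⁻ x, ENNReal.ofReal (f x) = 1

/-- The integral `∫ φ dP ∈ [-∞,∞]` of an extended-real function, as the integral of the positive
part minus the integral of the negative part. A density in `𝓕_d` is bounded, so for its logarithm
and a finite measure the first term is finite. -/
def extIntegral {d : ℕ} (φ : EuclideanSpace ℝ (Fin d) → EReal)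
    (P : Measure (EuclideanSpace ℝ (Fin d))) : EReal :=
  ((∫⁻ x, (φ x).toENNReal ∂P : ENNReal) : EReal) - ((∫⁻ x, (-φ x).toENNReal ∂P : ENNReal) : EReal)

/-- The class `𝓟_d` of probability measures on `ℝᵈ` with finite first moment that give mass
less than one to every hyperplane. -/
structure InClassP {d : ℕ} (P : Measure (EuclideanSpace ℝ (Fin d))) : Prop where
  isProbabilityMeasure : IsProbabilityMeasure P
  finite_mean : ∫⁻ x, ENNReal.ofReal ‖x‖ ∂P < ⊤
  hyperplane_lt_one : ∀ v : EuclideanSpace ℝ (Fin d), v ≠ 0 → ∀ c : ℝ,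
    P {x | inner ℝ v x = c} < 1

/-- `f` is a maximiser of `g ↦ ∫ log g dP` over `g ∈ 𝓕_d`. -/
def IsMaximiser {d : ℕ} (P : Measure (EuclideanSpace ℝ (Fin d)))
    (f : EuclideanSpace ℝ (Fin d) → ℝ) : Prop :=
  IsLogConcaveDensity f ∧
    ∀ g : EuclideanSpace ℝ (Fin d) → ℝ, IsLogConcaveDensity g →
      extIntegral (logFun g) P ≤ extIntegral (logFun f) P

/-- `ψ*(P)` is well-defined: `P` lies in `𝓟_d`, and the maximiser exists and is unique. -/
def ProjWellDefined {d : ℕ} (P : Measure (EuclideanSpace ℝ (Fin d))) : Prop :=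
  InClassP P ∧ ∃! f : EuclideanSpace ℝ (Fin d) → ℝ, IsMaximiser P f

open Classical in
/-- The log-concave projection `ψ*(P) = argmax_{f ∈ 𝓕_d} ∫ log f dP`
(with the value `0` if there is no maximiser). -/
def logConcaveProj {d : ℕ} (P : Measure (EuclideanSpace ℝ (Fin d))) :
    EuclideanSpace ℝ (Fin d) → ℝ :=
  if h : ∃ f : EuclideanSpace ℝ (Fin d) → ℝ, IsMaximiser P f then h.choose else 0

/-- The empirical distribution `n⁻¹ ∑_{i < n} δ_{x i}` of the first `n` points of a sequence. -/
def empirical {d : ℕ} (x : ℕ → EuclideanSpace ℝ (Fin d)) (n : ℕ) :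
    Measure (EuclideanSpace ℝ (Fin d)) :=
  (n : ENNReal)⁻¹ • ∑ i ∈ Finset.range n, Measure.dirac (x i)

end

end LogConcaveMLE

namespace LogConcaveMLE

/-! The core is the compactness statement `exists_subseq_density`: if `Q k` tends weakly to `P` in
the class and the densities `F k` have log-likelihoods under `Q k` bounded below, then a subsequence
has a limit in the class of densities, and the log-likelihood is upper semicontinuous along it. A
measure in the class charges finitely many open sets surrounding its mean
(`InClassP.exists_finset`). A density whose likelihood is not too small must be large somewhere on
each of them, so convexity of superlevel sets bounds it below on a fixed ball. Total mass one then
bounds its supremum (`exists_uniform_bounds`) and forces a common exponential envelope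
(`exists_envelope`). Hypographical limits of such densities are almost everywhere limits, so
dominated convergence keeps the mass equal to one, while `lintegral_le_liminf_of_tendsto` controls
the likelihood when integrand and measure vary together.

With a constant sequence of measures this gives existence of the maximiser. Uniqueness comes from
comparing two maximisers with their normalised geometric mean.

For consistency, the strong law gives, almost surely, weak convergence of the empirical measures and
convergence of the likelihood of the limit density when that likelihood is finite. Any subsequence
of the estimators then has a further subsequence whose limit is again a maximiser for `P`, hence the
projection of `P`. The bound on the projection over one large sphere passes to the estimators, and
log-concavity propagates it outwards with any positive rate below `α₀`. Dominated convergence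
finishes the proof (`tendsto_weighted_logConcaveProj`). -/

/-- The Euclidean space `ℝᵈ`. -/
abbrev Eucl (d : ℕ) : Type := EuclideanSpace ℝ (Fin d)

/-! ### Log-concave functions and convex sets around a point -/

/-- Multiplicative form of concavity of `log f`. -/
def LogConcave {d : ℕ} (f : Eucl d → ℝ) : Prop :=
  ∀ x y : Eucl d, ∀ a b : ℝ, 0 < a → 0 < b → a + b = 1 → f x ^ a * f y ^ b ≤ f (a • x + b • y)

theorem isConcave_logFun_iff {d : ℕ} {f : Eucl d → ℝ} (hf : ∀ x, 0 ≤ f x) :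
    IsConcave (logFun f) ↔ LogConcave f := by
  unfold IsConcave LogConcave logFun
  refine forall₂_congr fun x y => forall₂_congr fun a b => forall₃_congr fun ha hb _ => ?_
  rw [← ENNReal.log_rpow, ← ENNReal.log_rpow, ← ENNReal.log_mul_add, ENNReal.log_le_log_iff,
    ENNReal.ofReal_rpow_of_nonneg (hf x) ha.le, ENNReal.ofReal_rpow_of_nonneg (hf y) hb.le,
    ← ENNReal.ofReal_mul (Real.rpow_nonneg (hf x) a), ENNReal.ofReal_le_ofReal_iff (hf _)]

namespace LogConcave

variable {d : ℕ} {f : Eucl d → ℝ}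

theorem le_of_le (hf : LogConcave f) {x y : Eucl d} {a b p q : ℝ} (ha : 0 < a) (hb : 0 < b)
    (hab : a + b = 1) (hp : 0 ≤ p) (hq : 0 ≤ q) (hx : p ≤ f x) (hy : q ≤ f y) :
    p ^ a * q ^ b ≤ f (a • x + b • y) :=
  (mul_le_mul (Real.rpow_le_rpow hp hx ha.le) (Real.rpow_le_rpow hq hy hb.le)
    (Real.rpow_nonneg hq b) (Real.rpow_nonneg (hp.trans hx) a)).trans (hf x y a b ha hb hab)

theorem exp_le (hf : LogConcave f) {x y : Eucl d} {a b p q : ℝ} (ha : 0 < a) (hb : 0 < b)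
    (hab : a + b = 1) (hx : Real.exp p ≤ f x) (hy : Real.exp q ≤ f y) :
    Real.exp (a * p + b * q) ≤ f (a • x + b • y) := by
  have := hf.le_of_le ha hb hab (Real.exp_pos p).le (Real.exp_pos q).le hx hy
  rwa [← Real.exp_mul, ← Real.exp_mul, ← Real.exp_add, mul_comm p, mul_comm q] at this

theorem convex_superlevel (hf : LogConcave f) {c : ℝ} (hc : 0 < c) :
    Convex ℝ {x | c ≤ f x} := by
  rw [convex_iff_forall_pos]
  intro x hx y hy a b ha hb hab
  have := hf.le_of_le ha hb hab hc.le hc.le hx hy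
  rwa [← Real.rpow_add hc, hab, Real.rpow_one] at this

theorem convex_support (hf : LogConcave f) : Convex ℝ {x | 0 < f x} := by
  rw [convex_iff_forall_pos]
  intro x hx y hy a b ha hb hab
  exact lt_of_lt_of_le (mul_pos (Real.rpow_pos_of_pos hx a) (Real.rpow_pos_of_pos hy b))
    (hf x y a b ha hb hab)

theorem concaveOn_log (hf : LogConcave f) {s : Set (Eucl d)} (hs : Convex ℝ s)
    (hpos : ∀ x ∈ s, 0 < f x) : ConcaveOn ℝ s (fun x => Real.log (f x)) := by
  rw [concaveOn_iff_forall_pos]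
  refine ⟨hs, fun x hx y hy a b ha hb hab => ?_⟩
  have h := hf x y a b ha hb hab
  have h1 := Real.rpow_pos_of_pos (hpos x hx) a
  have h2 := Real.rpow_pos_of_pos (hpos y hy) b
  have h3 := Real.log_le_log (mul_pos h1 h2) h
  rwa [Real.log_mul h1.ne' h2.ne', Real.log_rpow (hpos x hx), Real.log_rpow (hpos y hy)] at h3

theorem continuousOn (hf : LogConcave f) {s : Set (Eucl d)} (hs : Convex ℝ s) (hso : IsOpen s)
    (hpos : ∀ x ∈ s, 0 < f x) : ContinuousOn f s := by
  have h := ((hf.concaveOn_log hs hpos).continuousOn hso).rexp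
  exact h.congr fun x hx => (Real.exp_log (hpos x hx)).symm

/-- A log-concave function that is much smaller on a sphere than at the centre decays
exponentially outside of it. -/
theorem le_exp_of_sphere (hf : LogConcave f) (hf0 : ∀ x, 0 ≤ f x) {x₀ : Eucl d} {t s R : ℝ}
    (hR : 0 < R)
    (h0 : Real.exp t ≤ f x₀) (hs : ∀ w, ‖w - x₀‖ = R → f w ≤ Real.exp (t - s)) {z : Eucl d}
    (hz : R ≤ ‖z - x₀‖) : f z ≤ Real.exp (t - s * ‖z - x₀‖ / R) := by
  rcases hz.eq_or_lt with hz | hz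
  · rw [← hz, mul_div_assoc, div_self hR.ne', mul_one]
    exact hs z hz.symm
  rcases (hf0 z).eq_or_lt with hfz | hfz
  · rw [← hfz]; positivity
  set r := ‖z - x₀‖ with hr
  have hrpos : 0 < r := hR.trans hz
  have hlt : R / r < 1 := (div_lt_one hrpos).2 hz
  have hpos : 0 < R / r := div_pos hR hrpos
  have h1 := hf.exp_le (x := x₀) (y := z) (a := 1 - R / r) (b := R / r) (p := t)
    (q := Real.log (f z)) (by linarith) hpos (by ring) h0 (Real.exp_log hfz).le
  have h2 : ‖(1 - R / r) • x₀ + (R / r) • z - x₀‖ = R := by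
    have : (1 - R / r) • x₀ + (R / r) • z - x₀ = (R / r) • (z - x₀) := by module
    rw [this, norm_smul, Real.norm_of_nonneg hpos.le, ← hr]
    field_simp
  have h3 := Real.exp_le_exp.1 (h1.trans (hs _ h2))
  rw [← Real.exp_log hfz, Real.exp_le_exp]
  have h4 : (R / r) * Real.log (f z) ≤ (R / r) * t - s := by linarith
  have h5 : Real.log (f z) = (r / R) * ((R / r) * Real.log (f z)) := by field_simp
  rw [h5]
  calc _ ≤ (r / R) * ((R / r) * t - s) := by gcongr
    _ = _ := by field_simp

end LogConcave

/-- Sets `A i` that lie in every direction from `x` have a finite subfamily such that each convex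
set meeting it contains a fixed ball around `x`. -/
theorem exists_finset_forall_ball_subset {d : ℕ} (hd : 1 ≤ d) {ι : Type*} (x : Eucl d)
    (A : ι → Set (Eucl d))
    (hA : ∀ u : Eucl d, ‖u‖ = 1 → ∃ i, ∃ c : ℝ, 0 < c ∧ ∃ R : ℝ, ∀ y ∈ A i,
      ‖y - x‖ ≤ R ∧ c ≤ inner ℝ u (y - x)) :
    ∃ s : Finset ι, ∃ ρ : ℝ, 0 < ρ ∧ ∀ C : Set (Eucl d), Convex ℝ C →
      (∀ i ∈ s, (C ∩ A i).Nonempty) → Metric.ball x ρ ⊆ C := by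
  classical
  have : Nonempty (Fin d) := ⟨⟨0, hd⟩⟩
  have hA' : ∀ u : Metric.sphere (0 : Eucl d) 1, ∃ i, ∃ c : ℝ, 0 < c ∧ ∃ δ : ℝ, 0 < δ ∧
      ∀ y ∈ A i, ∀ v : Eucl d, ‖v - u‖ < δ → c ≤ inner ℝ v (y - x) := by
    intro u
    obtain ⟨i, c, hc, R, h⟩ := hA u (by simp)
    -- Points of `A i` are within `R` of `x`, so tilting `u` by this much costs at most `c / 2` in
    -- the inner product. The condition is thus open in the direction, and compactness of the sphere
    -- applies.
    refine ⟨i, c / 2, by positivity, c / (2 * (|R| + 1)), by positivity, fun y hy v hv => ?_⟩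
    obtain ⟨h1, h2⟩ := h y hy
    have h3 : |inner ℝ (v - u) (y - x)| ≤ c / 2 := by
      refine (abs_real_inner_le_norm _ _).trans ?_
      calc ‖v - u‖ * ‖y - x‖ ≤ c / (2 * (|R| + 1)) * (|R| + 1) := by
            gcongr
            exact h1.trans ((le_abs_self R).trans (by linarith))
        _ = c / 2 := by field_simp
    rw [inner_sub_left] at h3
    linarith [(abs_le.1 h3).1]
  choose i c hc δ hδ h using hA'
  obtain ⟨t, ht⟩ := (isCompact_sphere (0 : Eucl d) 1).elim_finite_subcover
    (fun u : Metric.sphere (0 : Eucl d) 1 => Metric.ball (u : Eucl d) (δ u))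
    (fun _ => Metric.isOpen_ball)
    (fun u hu => Set.mem_iUnion.2 ⟨⟨u, hu⟩, Metric.mem_ball_self (hδ _)⟩)
  have htne : t.Nonempty := by
    obtain ⟨u, hu⟩ := NormedSpace.sphere_nonempty (E := Eucl d) (x := 0) (r := 1) |>.2 zero_le_one
    obtain ⟨w, hw, -⟩ := Set.mem_iUnion₂.1 (ht hu)
    exact ⟨w, hw⟩
  refine ⟨t.image i, t.inf' htne c, (Finset.lt_inf'_iff htne).2 fun u _ => hc u,
    fun C hC hCA x' hx' => ?_⟩
  by_contra hxC
  have hCA' : ∀ u : t, ∃ y, y ∈ C ∧ y ∈ A (i u) := fun u =>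
    hCA _ (Finset.mem_image_of_mem i u.2)
  choose y hyC hyA using hCA'
  have hsub : convexHull ℝ (Set.range y) ⊆ C :=
    convexHull_min (Set.range_subset_iff.2 hyC) hC
  obtain ⟨g, r, hg1, hg2⟩ := geometric_hahn_banach_point_closed (convex_convexHull ℝ (Set.range y))
    (Set.finite_range y |>.isClosed_convexHull ℝ) (fun hmem => hxC (hsub hmem))
  set v := (InnerProductSpace.toDual ℝ (Eucl d)).symm g with hv
  have hgv : ∀ w, g w = inner ℝ v w := fun w => by
    rw [hv, InnerProductSpace.toDual_symm_apply]
  have hlt : ∀ u : t, inner ℝ v x' < inner ℝ v (y u) := fun u => by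
    rw [← hgv, ← hgv]
    exact hg1.trans (hg2 _ (subset_convexHull ℝ _ ⟨u, rfl⟩))
  have hv0 : v ≠ 0 := by
    rintro h0
    obtain ⟨u, hu⟩ := htne
    simpa [h0] using hlt ⟨u, hu⟩
  have hvn : 0 < ‖v‖ := norm_pos_iff.2 hv0
  -- In direction `w` the separated point `x'` lies beyond all chosen points `y`. One of these is at
  -- least `c u` beyond `x`, whereas `x'` is closer to `x` than that.
  set w : Eucl d := -(‖v‖⁻¹ • v) with hw
  have hw1 : ‖w‖ = 1 := by
    rw [hw, norm_neg, norm_smul, norm_inv, norm_norm, inv_mul_cancel₀ hvn.ne']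
  obtain ⟨u, hut, hu⟩ := Set.mem_iUnion₂.1 (ht (show w ∈ Metric.sphere 0 1 by simp [hw1]))
  have h1 := h u (y ⟨u, hut⟩) (hyA ⟨u, hut⟩) w (by simpa [dist_eq_norm] using hu)
  have h2 : inner ℝ w (y ⟨u, hut⟩ - x') < 0 := by
    rw [hw, inner_neg_left, real_inner_smul_left, inner_sub_right]
    have := hlt ⟨u, hut⟩
    have h5 : 0 < ‖v‖⁻¹ := inv_pos.2 hvn
    nlinarith
  have h3 : |inner ℝ w (x' - x)| < c u := by
    refine (abs_real_inner_le_norm _ _).trans_lt ?_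
    rw [hw1, one_mul, ← dist_eq_norm]
    exact (Metric.mem_ball.1 hx').trans_le (Finset.inf'_le c hut)
  have h4 : inner ℝ w (y ⟨u, hut⟩ - x) = inner ℝ w (y ⟨u, hut⟩ - x') + inner ℝ w (x' - x) := by
    rw [← inner_add_right]; congr 1; abel
  linarith [(abs_lt.1 h3).2]

/-- Outside the sphere the radial decay applies, inside it the global bound `M` does. The maximum
covers both, and the term in `‖x₀‖` recentres the envelope at the origin. -/
theorem LogConcave.le_exp_sub_norm {d : ℕ} {f : Eucl d → ℝ} (hf : LogConcave f)
    (hf0 : ∀ x, 0 ≤ f x) {x₀ : Eucl d} {t s R M : ℝ} (hR : 0 < R) (hs0 : 0 ≤ s)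
    (h0 : Real.exp t ≤ f x₀) (hs : ∀ w, ‖w - x₀‖ = R → f w ≤ Real.exp (t - s))
    (hM : ∀ x, f x ≤ Real.exp M) (x : Eucl d) :
    f x ≤ Real.exp (max t (M + s) + s / R * ‖x₀‖ - s / R * ‖x‖) := by
  have hsR : 0 ≤ s / R := div_nonneg hs0 hR.le
  have htri : s / R * ‖x‖ - s / R * ‖x₀‖ ≤ s / R * ‖x - x₀‖ := by
    rw [← mul_sub]; gcongr; exact norm_sub_norm_le x x₀
  rcases le_total R ‖x - x₀‖ with h | h
  · refine (hf.le_exp_of_sphere hf0 hR h0 hs h).trans (Real.exp_le_exp.2 ?_)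
    rw [mul_div_right_comm]
    linarith [le_max_left t (M + s)]
  · refine (hM x).trans (Real.exp_le_exp.2 ?_)
    have : s / R * ‖x - x₀‖ ≤ s := by
      calc _ ≤ s / R * R := by gcongr
        _ = s := by field_simp
    linarith [le_max_right t (M + s)]

theorem lintegral_exp_sub_norm_lt_top {d : ℕ} (a : ℝ) {b : ℝ} (hb : 0 < b) :
    ∫⁻ x : Eucl d, ENNReal.ofReal (Real.exp (a - b * ‖x‖)) < ⊤ := by
  obtain ⟨K, hK⟩ : ∃ K : ℝ, ∀ u : ℝ, 0 ≤ u → Real.exp (a - b * u) ≤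
      K * (1 + u) ^ (-((d : ℝ) + 1)) := by
    refine ⟨(d + 1).factorial * Real.exp (a + b) / b ^ (d + 1), fun u hu => ?_⟩
    have h1 := Real.pow_div_factorial_le_exp (b * (1 + u)) (by positivity) (d + 1)
    have h2 : (0 : ℝ) < 1 + u := by linarith
    have h3 : (1 + u) ^ (-((d : ℝ) + 1)) = ((1 + u) ^ (d + 1))⁻¹ := by
      rw [Real.rpow_neg h2.le, ← Nat.cast_succ, Real.rpow_natCast]
    have h4 : Real.exp (a - b * u) = Real.exp (a + b) * (Real.exp (b * (1 + u)))⁻¹ := by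
      rw [← Real.exp_neg, ← Real.exp_add]; ring_nf
    have h5 : (0 : ℝ) < (b * (1 + u)) ^ (d + 1) / (d + 1).factorial := by positivity
    rw [h3, h4]
    calc _ ≤ Real.exp (a + b) * ((b * (1 + u)) ^ (d + 1) / (d + 1).factorial)⁻¹ := by gcongr
      _ = _ := by rw [mul_pow]; field_simp
  have hint : Integrable (fun x : Eucl d => K * (1 + ‖x‖) ^ (-((d : ℝ) + 1))) :=
    (integrable_one_add_norm (by simp)).const_mul K
  refine lt_of_le_of_lt (lintegral_mono fun x => ?_) hint.lintegral_lt_top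
  exact ENNReal.ofReal_le_ofReal (hK _ (norm_nonneg x))

/-! ### Bounds and envelopes for log-concave densities -/

namespace IsLogConcaveDensity

variable {d : ℕ} {f : Eucl d → ℝ}

theorem logConcave (hf : IsLogConcaveDensity f) : LogConcave f :=
  (isConcave_logFun_iff hf.nonneg).1 hf.concave_log

theorem measurable (hf : IsLogConcaveDensity f) : Measurable f := hf.usc.measurable

theorem mul_volume_le_one (hf : IsLogConcaveDensity f) {s : Set (Eucl d)} {c : ℝ}
    (hc : 0 ≤ c) (hs : MeasurableSet s) (h : ∀ x ∈ s, c ≤ f x) :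
    c * volume.real s ≤ 1 := by
  have h1 : ENNReal.ofReal c * volume s ≤ 1 := by
    rw [← hf.lintegral_eq_one, ← setLIntegral_const]
    refine (setLIntegral_mono' hs fun x hx => ENNReal.ofReal_le_ofReal (h x hx)).trans ?_
    exact setLIntegral_le_lintegral _ _
  have h2 := ENNReal.toReal_mono ENNReal.one_ne_top h1
  rwa [ENNReal.toReal_mul, ENNReal.toReal_ofReal hc, ENNReal.toReal_one] at h2

theorem volume_ball_pos (x : Eucl d) {r : ℝ} (hr : 0 < r) :
    0 < volume.real (Metric.ball x r) :=
  ENNReal.toReal_pos (Metric.measure_ball_pos volume x hr).ne' measure_ball_lt_top.ne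

theorem volume_ball_eq (x y : Eucl d) (r : ℝ) :
    volume.real (Metric.ball x r) = volume.real (Metric.ball y r) := by
  rw [Measure.real, Measure.real, Measure.addHaar_ball_center, ← Measure.addHaar_ball_center _ y]

/-- A point where the density is large, together with a ball where it is not small, forces the
density to be large on a smaller ball, which bounds its value. -/
theorem log_value_le (hf : IsLogConcaveDensity f) {x₀ z : Eucl d} {ρ t m l : ℝ} (hρ : 0 < ρ)
    (hball : ∀ y ∈ Metric.ball x₀ ρ, Real.exp t ≤ f y) (hz : Real.exp m ≤ f z)
    (hl0 : 0 < l) (hl1 : l < 1) :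
    (1 - l) * m + l * t ≤ -Real.log (volume.real (Metric.ball (0 : Eucl d) (l * ρ))) := by
  have h1 : ∀ y ∈ Metric.ball ((1 - l) • z + l • x₀) (l * ρ),
      Real.exp ((1 - l) * m + l * t) ≤ f y := by
    intro y hy
    set y' : Eucl d := x₀ + l⁻¹ • (y - ((1 - l) • z + l • x₀)) with hy'
    have hmem : y' ∈ Metric.ball x₀ ρ := by
      rw [mem_ball_iff_norm] at hy ⊢
      rw [hy', add_sub_cancel_left, norm_smul, norm_inv, Real.norm_of_nonneg hl0.le]
      rw [inv_mul_lt_iff₀ hl0]; exact hy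
    have heq : y = (1 - l) • z + l • y' := by
      rw [hy', smul_add, smul_smul, mul_inv_cancel₀ hl0.ne', one_smul]; abel
    rw [heq]
    exact hf.logConcave.exp_le (by linarith) hl0 (by ring) hz (hball _ hmem)
  have h2 := hf.mul_volume_le_one (Real.exp_pos _).le Metric.isOpen_ball.measurableSet h1
  rw [volume_ball_eq _ 0] at h2
  have h3 := volume_ball_pos (0 : Eucl d) (mul_pos hl0 hρ)
  rw [← Real.exp_le_exp, Real.exp_neg, Real.exp_log h3]
  rwa [← le_div_iff₀ h3, one_div] at h2

/-- A convex set with empty interior is null, being contained in its own frontier. If every positive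
superlevel set were of this kind, the density would vanish almost everywhere. -/
theorem exists_ball_exp_le (hf : IsLogConcaveDensity f) :
    ∃ x₀ : Eucl d, ∃ ρ : ℝ, 0 < ρ ∧ ∃ t : ℝ, ∀ y ∈ Metric.ball x₀ ρ, Real.exp t ≤ f y := by
  by_contra! hcon
  have h0 : ∀ n : ℕ, volume {x | Real.exp (-n) ≤ f x} = 0 := by
    intro n
    have hconv := hf.logConcave.convex_superlevel (Real.exp_pos (-n))
    have hint : interior {x | Real.exp (-n) ≤ f x} = ∅ := by
      by_contra hne
      obtain ⟨x, hx⟩ := Set.nonempty_iff_ne_empty.2 hne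
      obtain ⟨ρ, hρ, hsub⟩ := Metric.isOpen_iff.1 isOpen_interior x hx
      obtain ⟨y, hy, hlt⟩ := hcon x ρ hρ (-n)
      have hmem : y ∈ {x | Real.exp (-n) ≤ f x} := interior_subset (hsub hy)
      exact not_le.2 hlt hmem
    refine measure_mono_null ?_ (hconv.addHaar_frontier volume)
    rw [frontier, hint, Set.sdiff_empty]
    exact subset_closure
  have h1 : volume {x | 0 < f x} = 0 := by
    refine measure_mono_null (fun x hx => ?_) (measure_iUnion_null h0)
    obtain ⟨n, hn⟩ := exists_nat_ge (-Real.log (f x))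
    refine Set.mem_iUnion.2 ⟨n, ?_⟩
    rw [Set.mem_ofPred_eq, ← Real.exp_log hx, Real.exp_le_exp]
    linarith
  have h2 : ∫⁻ x, ENNReal.ofReal (f x) = 0 := by
    rw [lintegral_eq_zero_iff hf.measurable.ennreal_ofReal]
    rw [Filter.EventuallyEq, ae_iff]
    refine measure_mono_null (fun x hx => ?_) h1
    simpa using hx
  rw [hf.lintegral_eq_one] at h2
  exact one_ne_zero h2

theorem exists_le_exp (hf : IsLogConcaveDensity f) : ∃ M : ℝ, ∀ x, f x ≤ Real.exp M := by
  obtain ⟨x₀, ρ, hρ, t, ht⟩ := hf.exists_ball_exp_le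
  refine ⟨2 * (-Real.log (volume.real (Metric.ball (0 : Eucl d) (1 / 2 * ρ)))) - t, fun z => ?_⟩
  rcases (hf.nonneg z).eq_or_lt with hz | hz
  · rw [← hz]; positivity
  have := hf.log_value_le hρ ht (Real.exp_log hz).le (l := 1 / 2) (by norm_num) (by norm_num)
  rw [← Real.exp_log hz, Real.exp_le_exp]
  linarith

end IsLogConcaveDensity

theorem ball_subset_of_convex {d : ℕ} {D : Set (Eucl d)} (hD : Convex ℝ D) {x₀ z : Eucl d}
    {ρ l : ℝ} (hball : Metric.ball x₀ ρ ⊆ D) (hz : z ∈ D) (hl0 : 0 ≤ l) (hl1 : l < 1) :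
    Metric.ball (x₀ + l • (z - x₀)) ((1 - l) * ρ) ⊆ D := by
  intro y hy
  have hl : 0 < 1 - l := by linarith
  set y' : Eucl d := x₀ + (1 - l)⁻¹ • (y - (x₀ + l • (z - x₀))) with hy'
  have hmem : y' ∈ Metric.ball x₀ ρ := by
    rw [mem_ball_iff_norm] at hy ⊢
    rw [hy', add_sub_cancel_left, norm_smul, norm_inv, Real.norm_of_nonneg hl.le,
      inv_mul_lt_iff₀ hl]
    exact hy
  have heq : y = (1 - l) • y' + l • z := by
    rw [hy', smul_add, smul_smul, mul_inv_cancel₀ hl.ne', one_smul]; module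
  rw [heq]
  exact hD (hball hmem) hz hl.le hl0 (by ring)

/-- Log-concave densities that are bounded below on a common ball are small outside of a common
ball. -/
theorem exists_radius_le {d : ℕ} (x₀ : Eucl d) {ρ : ℝ} (hρ : 0 < ρ) (t : ℝ) :
    ∃ R : ℝ, 0 < R ∧ ∀ f : Eucl d → ℝ, IsLogConcaveDensity f →
      (∀ y ∈ Metric.ball x₀ ρ, Real.exp t ≤ f y) →
      ∀ z, R ≤ ‖z - x₀‖ → f z ≤ Real.exp (t - 1) := by
  set v := volume.real (Metric.ball (0 : Eucl d) (ρ / 2)) with hv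
  have hvpos : 0 < v := IsLogConcaveDensity.volume_ball_pos _ (by positivity)
  obtain ⟨N, hN⟩ := exists_nat_gt (1 / (Real.exp (t - 1) * v))
  have hNpos : (0 : ℝ) < N := lt_trans (by positivity) hN
  -- If `f z` exceeded the bound, the superlevel set would contain `N` disjoint balls of radius `ρ /
  -- 2`, with centres spaced by `ρ` along the first half of the segment from `x₀` to `z`. By the
  -- choice of `N` their mass exceeds one.
  refine ⟨2 * N * ρ, by positivity, fun f hf hball z hz => ?_⟩
  by_contra! hlt
  set D := {x | Real.exp (t - 1) ≤ f x} with hD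
  have hDc : Convex ℝ D := hf.logConcave.convex_superlevel (Real.exp_pos _)
  have hballD : Metric.ball x₀ ρ ⊆ D := fun y hy =>
    (Real.exp_le_exp.2 (by linarith)).trans (hball y hy)
  set r := ‖z - x₀‖ with hr
  have hrpos : 0 < r := lt_of_lt_of_le (by positivity) hz
  let c : ℕ → Eucl d := fun j => x₀ + (j * ρ / r) • (z - x₀)
  have hsub : ∀ j ∈ Finset.range N, Metric.ball (c j) (ρ / 2) ⊆ D := by
    intro j hj
    have hjN : (j : ℝ) ≤ N := by exact_mod_cast (Finset.mem_range.1 hj).le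
    have hl : j * ρ / r ≤ 1 / 2 := by
      rw [div_le_iff₀ hrpos]
      nlinarith
    refine (Metric.ball_subset_ball ?_).trans
      (ball_subset_of_convex hDc hballD hlt.le (l := j * ρ / r) (by positivity) (by linarith))
    nlinarith
  have hdisj : Set.PairwiseDisjoint (↑(Finset.range N))
      (fun j => Metric.ball (c j) (ρ / 2)) := by
    intro i _ j _ hij
    refine Metric.ball_disjoint_ball ?_
    have h1 : c i - c j = (((i : ℝ) - j) * ρ / r) • (z - x₀) := by
      simp only [c]; module
    rw [dist_eq_norm, h1, norm_smul, ← hr, Real.norm_eq_abs, abs_div, abs_mul, abs_of_pos hρ,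
      abs_of_pos hrpos, div_mul_cancel₀ _ hrpos.ne']
    have h2 : (1 : ℝ) ≤ |(i : ℝ) - j| := by
      have : (1 : ℤ) ≤ |(i : ℤ) - j| := Int.one_le_abs (by omega)
      exact_mod_cast this
    nlinarith
  have h1 := hf.mul_volume_le_one (Real.exp_pos (t - 1)).le
    (Finset.measurableSet_biUnion (Finset.range N) fun j _ =>
      (Metric.isOpen_ball (x := c j) (ε := ρ / 2)).measurableSet)
    (fun x hx => by
      obtain ⟨j, hj, hx⟩ := Set.mem_iUnion₂.1 hx
      exact hsub j hj hx)
  rw [measureReal_biUnion_finset hdisj (fun j _ => Metric.isOpen_ball.measurableSet)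
    (fun j _ => measure_ball_lt_top.ne), Finset.sum_congr rfl
    (fun j _ => IsLogConcaveDensity.volume_ball_eq (c j) 0 (ρ / 2)), Finset.sum_const,
    Finset.card_range, nsmul_eq_mul, ← hv] at h1
  rw [div_lt_iff₀ (by positivity)] at hN
  linarith

/-- Log-concave densities with a common upper bound and a common lower bound on a ball have a
common exponentially decreasing envelope. -/
theorem exists_envelope {d : ℕ} (x₀ : Eucl d) {ρ : ℝ} (hρ : 0 < ρ) (t M : ℝ) :
    ∃ a b : ℝ, 0 < b ∧ ∀ f : Eucl d → ℝ, IsLogConcaveDensity f →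
      (∀ y ∈ Metric.ball x₀ ρ, Real.exp t ≤ f y) → (∀ x, f x ≤ Real.exp M) →
      ∀ x, f x ≤ Real.exp (a - b * ‖x‖) := by
  obtain ⟨R, hR, h⟩ := exists_radius_le x₀ hρ t
  refine ⟨_, 1 / R, by positivity, fun f hf hball hM x =>
    hf.logConcave.le_exp_sub_norm hf.nonneg hR zero_le_one
      (hball x₀ (Metric.mem_ball_self hρ)) (fun w hw => h f hf hball w hw.ge) hM x⟩

theorem IsLogConcaveDensity.exists_envelope {d : ℕ} {f : Eucl d → ℝ}
    (hf : IsLogConcaveDensity f) :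
    ∃ a b : ℝ, 0 < b ∧ ∀ x, f x ≤ Real.exp (a - b * ‖x‖) := by
  obtain ⟨x₀, ρ, hρ, t, ht⟩ := hf.exists_ball_exp_le
  obtain ⟨M, hM⟩ := hf.exists_le_exp
  obtain ⟨a, b, hb, h⟩ := LogConcaveMLE.exists_envelope x₀ hρ t M
  exact ⟨a, b, hb, h f hf ht hM⟩

/-! ### The log-likelihood as a nonnegative integral -/

/-- The nonnegative extended number `M - log t`, where `e^M` is an upper bound for `t`. -/
noncomputable def cost (M t : ℝ) : ENNReal :=
  if t ≤ 0 then ⊤ else ENNReal.ofReal (M - Real.log t)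

theorem cost_of_nonpos {M t : ℝ} (h : t ≤ 0) : cost M t = ⊤ := if_pos h

theorem cost_of_pos {M t : ℝ} (h : 0 < t) : cost M t = ENNReal.ofReal (M - Real.log t) :=
  if_neg h.not_ge

theorem measurable_cost (M : ℝ) : Measurable (cost M) :=
  Measurable.ite measurableSet_Iic measurable_const
    (measurable_const.sub Real.measurable_log).ennreal_ofReal

theorem cost_antitone (M : ℝ) : Antitone (cost M) := by
  intro s t hst
  rcases le_or_gt s 0 with hs | hs
  · rw [cost_of_nonpos hs]; exact le_top
  · rw [cost_of_pos hs, cost_of_pos (hs.trans_le hst)]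
    exact ENNReal.ofReal_le_ofReal (by linarith [Real.log_le_log hs hst])

section extIntegral

variable {d : ℕ} {f : Eucl d → ℝ} {M : ℝ} (P : Measure (Eucl d)) [IsProbabilityMeasure P]

/-- The upper bound keeps the positive part finite, so no `⊤ - ⊤` occurs. The likelihood becomes one
nonnegative integral, open to Markov's inequality and semicontinuity arguments. -/
theorem extIntegral_logFun_eq (hf : Measurable f) (hM : ∀ x, f x ≤ Real.exp M) :
    extIntegral (logFun f) P = (M : EReal) - ((∫⁻ x, cost M (f x) ∂P : ENNReal) : EReal) := by
  -- The relation between `cost` and `log f`, with all negative terms moved across so that no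
  -- truncated subtraction appears.
  have hpt : ∀ x, (logFun f x).toENNReal + (cost M (f x) + ENNReal.ofReal (-M)) =
      ENNReal.ofReal M + (-logFun f x).toENNReal := by
    intro x
    rcases le_or_gt (f x) 0 with h | h
    · simp [logFun, cost_of_nonpos h, ENNReal.ofReal_of_nonpos h]
    · have hl : Real.log (f x) ≤ M := by
        rw [← Real.log_exp M]; exact Real.log_le_log h (hM x)
      rw [logFun, ENNReal.log_ofReal_of_pos h, cost_of_pos h, ← EReal.coe_neg,
        EReal.real_coe_toENNReal, EReal.real_coe_toENNReal]
      generalize Real.log (f x) = l at hl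
      rcases le_total 0 M with h1 | h1 <;> rcases le_total 0 l with h2 | h2
      · rw [ENNReal.ofReal_of_nonpos (p := -M) (by linarith),
          ENNReal.ofReal_of_nonpos (p := -l) (by linarith), add_zero, add_zero,
          ← ENNReal.ofReal_add h2 (by linarith)]
        congr 1; ring
      · rw [ENNReal.ofReal_of_nonpos (p := -M) (by linarith),
          ENNReal.ofReal_of_nonpos (p := l) (by linarith), add_zero, zero_add,
          ← ENNReal.ofReal_add h1 (by linarith)]
        congr 1
      · rw [show M = 0 by linarith, show l = 0 by linarith]; simp
      · rw [ENNReal.ofReal_of_nonpos (p := M) (by linarith),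
          ENNReal.ofReal_of_nonpos (p := l) (by linarith), zero_add, zero_add,
          ← ENNReal.ofReal_add (by linarith) (by linarith)]
        congr 1; ring
  have hlog : Measurable (logFun f) := ENNReal.measurable_log.comp hf.ennreal_ofReal
  have hint := lintegral_congr (μ := P) hpt
  rw [lintegral_add_left hlog.ereal_toENNReal, lintegral_add_right _ measurable_const,
    lintegral_add_left measurable_const, lintegral_const, lintegral_const, measure_univ,
    mul_one, mul_one] at hint
  have hpos : ∫⁻ x, (logFun f x).toENNReal ∂P ≠ ⊤ := by
    refine ne_top_of_le_ne_top (b := ENNReal.ofReal M) ENNReal.ofReal_ne_top ?_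
    calc _ ≤ ∫⁻ _, ENNReal.ofReal M ∂P := by
          refine lintegral_mono fun x => ?_
          rw [← EReal.real_coe_toENNReal, ← Real.log_exp M,
            ← ENNReal.log_ofReal_of_pos (Real.exp_pos M)]
          exact EReal.toENNReal_le_toENNReal
            (ENNReal.log_le_log (ENNReal.ofReal_le_ofReal (hM x)))
      _ = _ := by simp
  unfold extIntegral
  generalize ∫⁻ x, (logFun f x).toENNReal ∂P = p at *
  generalize ∫⁻ x, (-logFun f x).toENNReal ∂P = q at *
  generalize ∫⁻ x, cost M (f x) ∂P = J at *
  rcases eq_or_ne J ⊤ with rfl | hJ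
  · have hq : q = ⊤ := by
      by_contra hq
      rw [top_add, add_top] at hint
      exact ENNReal.add_ne_top.2 ⟨ENNReal.ofReal_ne_top, hq⟩ hint.symm
    rw [hq]
    lift p to NNReal using hpos
    rfl
  · have hq : q ≠ ⊤ := by
      rintro rfl
      rw [add_top] at hint
      exact ENNReal.add_ne_top.2 ⟨hpos, ENNReal.add_ne_top.2 ⟨hJ, ENNReal.ofReal_ne_top⟩⟩ hint
    have hr := congrArg ENNReal.toReal hint
    rw [ENNReal.toReal_add hpos (by finiteness), ENNReal.toReal_add hJ (by finiteness),
      ENNReal.toReal_add (by finiteness) hq, ENNReal.toReal_ofReal', ENNReal.toReal_ofReal'] at hr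
    rw [← EReal.coe_ennreal_toReal hpos, ← EReal.coe_ennreal_toReal hJ,
      ← EReal.coe_ennreal_toReal hq, ← EReal.coe_sub, ← EReal.coe_sub, EReal.coe_eq_coe_iff]
    have := max_zero_sub_max_neg_zero_eq_self M
    linarith

/-- The clause `c ≤ M` is not redundant: for `c > M` the right-hand side truncates to zero, which
the cost integral may attain. -/
theorem le_extIntegral_iff (hf : Measurable f) (hM : ∀ x, f x ≤ Real.exp M) {c : ℝ} :
    (c : EReal) ≤ extIntegral (logFun f) P ↔
      c ≤ M ∧ ∫⁻ x, cost M (f x) ∂P ≤ ENNReal.ofReal (M - c) := by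
  rw [extIntegral_logFun_eq P hf hM]
  generalize ∫⁻ x, cost M (f x) ∂P = J
  rcases eq_or_ne J ⊤ with rfl | hJ
  · simp
  · rw [← EReal.coe_ennreal_toReal hJ, ← EReal.coe_sub, EReal.coe_le_coe_iff,
      ← ENNReal.ofReal_toReal hJ]
    have h0 : 0 ≤ J.toReal := ENNReal.toReal_nonneg
    rw [ENNReal.toReal_ofReal h0]
    constructor
    · intro h
      exact ⟨by linarith, ENNReal.ofReal_le_ofReal (by linarith)⟩
    · rintro ⟨h1, h2⟩
      have := (ENNReal.ofReal_le_ofReal_iff (by linarith)).1 h2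
      linarith

/-- A large value of `∫ log f dP` forces the superlevel sets of `f` to carry much mass. -/
theorem mul_measure_compl_superlevel_le (hf : Measurable f) (hM : ∀ x, f x ≤ Real.exp M)
    {c t : ℝ} (ht : t < M) (hc : (c : EReal) ≤ extIntegral (logFun f) P) :
    P {x | Real.exp t ≤ f x}ᶜ ≤ ENNReal.ofReal ((M - c) / (M - t)) := by
  have h1 := ((le_extIntegral_iff P hf hM).1 hc).2
  have h2 : {x | Real.exp t ≤ f x}ᶜ ⊆ {x | ENNReal.ofReal (M - t) ≤ cost M (f x)} := by
    intro x hx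
    have hlt : f x < Real.exp t := not_le.1 hx
    have := cost_antitone M hlt.le
    rwa [cost_of_pos (Real.exp_pos t), Real.log_exp] at this
  have h3 : P {x | ENNReal.ofReal (M - t) ≤ cost M (f x)} ≤ _ :=
    meas_ge_le_lintegral_div ((measurable_cost M).comp hf).aemeasurable
      (by simpa using ht) ENNReal.ofReal_ne_top
  rw [ENNReal.ofReal_div_of_pos (by linarith)]
  exact (measure_mono h2).trans (h3.trans (ENNReal.div_le_div_right h1 _))

end extIntegral

/-! ### A priori bounds from the position of the mass -/

/-- Bounds that depend only on a lower bound for `∫ log f dP` and on the position of the mass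
of `P`. -/
theorem exists_uniform_bounds {d : ℕ} (s : Finset (Set (Eucl d))) (x₀ : Eucl d)
    {ρ : ℝ} (hρ : 0 < ρ)
    (hs : ∀ C : Set (Eucl d), Convex ℝ C → (∀ A ∈ s, (C ∩ A).Nonempty) → Metric.ball x₀ ρ ⊆ C)
    {η : ℝ} (hη : 0 < η) (hη1 : η < 1) (c : ℝ) :
    ∃ M t : ℝ, ∀ P : Measure (Eucl d), IsProbabilityMeasure P →
      (∀ A ∈ s, ENNReal.ofReal η ≤ P A) → ∀ f : Eucl d → ℝ, IsLogConcaveDensity f →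
      (c : EReal) ≤ extIntegral (logFun f) P →
      (∀ x, f x ≤ Real.exp M) ∧ ∀ y ∈ Metric.ball x₀ ρ, Real.exp t ≤ f y := by
  set V := -Real.log (volume.real (Metric.ball (0 : Eucl d) (η / 2 * ρ))) with hV
  set B := max 0 (2 * V + |c| + 3) with hB
  have hB0 : 0 ≤ B := le_max_left _ _
  refine ⟨B, c - (B + |c| + 1) / η, fun P hP hPA f hf hfc => ?_⟩
  obtain ⟨M₁, hM₁⟩ := hf.exists_le_exp
  obtain ⟨w, r, hr, t₁, ht₁⟩ := hf.exists_ball_exp_le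
  have hw := ht₁ w (Metric.mem_ball_self hr)
  have hbdd : BddAbove (Set.range f) := ⟨Real.exp M₁, by rintro _ ⟨x, rfl⟩; exact hM₁ x⟩
  set S := ⨆ x, f x with hS
  have hSpos : 0 < S := (Real.exp_pos t₁).trans_le (hw.trans (le_ciSup hbdd w))
  set M := Real.log S with hM
  have hexpM : Real.exp M = S := Real.exp_log hSpos
  have hfM : ∀ x, f x ≤ Real.exp M := fun x => hexpM ▸ le_ciSup hbdd x
  obtain ⟨z, hz⟩ : ∃ z, Real.exp (M - 1) < f z := by
    refine exists_lt_of_lt_ciSup ?_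
    rw [← hS, ← hexpM, Real.exp_lt_exp]; linarith
  have hcM : c ≤ M := ((le_extIntegral_iff P hf.measurable hfM).1 hfc).1
  have hc1 := le_abs_self c
  have hc2 := neg_abs_le c
  have hm0 := le_max_left 0 M
  have hmM := le_max_right 0 M
  -- Chosen so that Markov's inequality gives `{f < exp t}` mass below `η`; hence it contains no set
  -- of `s`.
  set t := M - (max 0 M + |c| + 1) / η with ht
  have hpos : 0 < (max 0 M + |c| + 1) / η := by positivity
  have hball : ∀ y ∈ Metric.ball x₀ ρ, Real.exp t ≤ f y := by
    refine hs {x | Real.exp t ≤ f x} (hf.logConcave.convex_superlevel (Real.exp_pos t))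
      fun A hA => ?_
    by_contra hne
    have hsub : A ⊆ {x | Real.exp t ≤ f x}ᶜ := fun y hy hy' => hne ⟨y, hy', hy⟩
    have h1 := (hPA A hA).trans ((measure_mono hsub).trans
      (mul_measure_compl_superlevel_le P hf.measurable hfM (by linarith : t < M) hfc))
    have h2 : (M - c) / (M - t) < η := by
      rw [div_lt_iff₀ (by linarith), ht, sub_sub_cancel, mul_div_cancel₀ _ hη.ne']
      linarith
    exact absurd h1 (not_le.2 ((ENNReal.ofReal_lt_ofReal_iff hη).2 h2))
  -- The level `t` falls with `M`, but with weight `η / 2` the loss `η / 2 * (M - t)` absorbs only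
  -- half of a positive `M`. The other half is bounded.
  have hval := hf.log_value_le hρ hball hz.le (l := η / 2) (by positivity) (by linarith)
  have hMB : M ≤ B := by
    rw [← hV] at hval
    have h1 : (1 - η / 2) * (M - 1) + η / 2 * t =
        M - 1 + η / 2 - (max 0 M + |c| + 1) / 2 := by
      rw [ht]; field_simp; ring
    rw [h1] at hval
    rcases le_total M 0 with h | h
    · exact h.trans hB0
    · rw [max_eq_right h] at hval
      exact le_max_of_le_right (by linarith)
  refine ⟨fun x => (hfM x).trans (Real.exp_le_exp.2 hMB), fun y hy =>
    (Real.exp_le_exp.2 ?_).trans (hball y hy)⟩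
  have : (max 0 M + |c| + 1) / η ≤ (B + |c| + 1) / η := by
    gcongr; exact max_le hB0 hMB
  linarith

/-- A measure in the class `𝓟_d` charges finitely many open sets such that every convex set
meeting them contains a fixed ball. -/
theorem InClassP.exists_finset {d : ℕ} (hd : 1 ≤ d) {P : Measure (Eucl d)} (hP : InClassP P) :
    ∃ s : Finset (Set (Eucl d)), ∃ x₀ : Eucl d, ∃ ρ : ℝ, 0 < ρ ∧
      (∀ A ∈ s, IsOpen A ∧ 0 < P A) ∧
      ∀ C : Set (Eucl d), Convex ℝ C → (∀ A ∈ s, (C ∩ A).Nonempty) → Metric.ball x₀ ρ ⊆ C := by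
  classical
  have := hP.isProbabilityMeasure
  have hint : Integrable (fun y : Eucl d => y) P := by
    refine ⟨measurable_id.aestronglyMeasurable, ?_⟩
    rw [hasFiniteIntegral_iff_norm]; exact hP.finite_mean
  -- The mean is the centre. If no charged open set lay strictly on the positive side in direction
  -- `u`, then `inner ℝ u (y - x₀)` would be nonpositive almost everywhere with integral zero, and a
  -- hyperplane would have full mass.
  set x₀ := ∫ y, y ∂P with hx₀
  obtain ⟨s, ρ, hρ, h⟩ := exists_finset_forall_ball_subset hd x₀
    (fun A : {A : Set (Eucl d) // IsOpen A ∧ 0 < P A} => (A : Set (Eucl d))) (by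
      intro u hu
      by_contra! hcon
      have hu0 : u ≠ 0 := by rintro rfl; simp at hu
      have hnull : ∀ n : ℕ,
          P ({y | 1 / ((n : ℝ) + 1) < inner ℝ u (y - x₀)} ∩ Metric.ball x₀ n) = 0 := by
        intro n
        by_contra hne
        obtain ⟨y, hy, hy'⟩ := hcon ⟨_, (isOpen_lt continuous_const (by fun_prop)).inter
          Metric.isOpen_ball, pos_iff_ne_zero.2 hne⟩ (1 / ((n : ℝ) + 1)) (by positivity) n
        exact not_lt.2 (hy' (mem_ball_iff_norm.1 hy.2).le).le hy.1
      have hle : ∀ᵐ y ∂P, inner ℝ u (y - x₀) ≤ 0 := by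
        rw [ae_iff]
        refine measure_mono_null (fun y hy => ?_) (measure_iUnion_null hnull)
        have hy : 0 < inner ℝ u (y - x₀) := not_le.1 hy
        obtain ⟨n, hn⟩ := exists_nat_one_div_lt hy
        obtain ⟨m, hm⟩ := exists_nat_gt ‖y - x₀‖
        refine Set.mem_iUnion.2 ⟨max n m, ?_, ?_⟩
        · refine lt_of_le_of_lt ?_ hn
          gcongr; exact le_max_left _ _
        · rw [mem_ball_iff_norm]
          exact hm.trans_le (by exact_mod_cast le_max_right _ _)
      have hint' : Integrable (fun y => inner ℝ u (y - x₀)) P :=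
        (hint.sub (integrable_const x₀)).const_inner u
      have hzero : ∫ y, inner ℝ u (y - x₀) ∂P = 0 := by
        have hsub : ∫ y, (y - x₀) ∂P = 0 := by
          rw [integral_sub hint (integrable_const x₀)]
          simp [hx₀]
        have h := integral_inner (𝕜 := ℝ) (f := fun y => y - x₀)
          (hint.sub (integrable_const x₀)) u
        rw [h, hsub, inner_zero_right]
      have hae : ∀ᵐ y ∂P, inner ℝ u y = inner ℝ u x₀ := by
        have h0 : 0 ≤ᵐ[P] fun y => -inner ℝ u (y - x₀) := by
          filter_upwards [hle] with y hy
          simpa using hy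
        have h1 := (integral_eq_zero_iff_of_nonneg_ae h0 hint'.neg).1 (by
          rw [integral_neg, hzero, neg_zero])
        filter_upwards [h1] with y hy
        rw [inner_sub_right] at hy
        simp only [Pi.zero_apply] at hy
        linarith
      have h1 := hP.hyperplane_lt_one u hu0 (inner ℝ u x₀)
      rw [prob_compl_eq_zero_iff (measurableSet_eq_fun (by fun_prop) measurable_const) |>.1
        (ae_iff.1 hae)] at h1
      exact lt_irrefl _ h1)
  refine ⟨Finset.image Subtype.val s, x₀, ρ, hρ, ?_, fun C hC hCA =>
    h C hC fun i hi => hCA _ (Finset.mem_image_of_mem _ hi)⟩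
  intro A hA
  obtain ⟨B, -, rfl⟩ := Finset.mem_image.1 hA
  exact B.2

/-- A convex set of full measure contains a ball. -/
theorem InClassP.exists_ball_subset {d : ℕ} (hd : 1 ≤ d) {P : Measure (Eucl d)} (hP : InClassP P)
    {C : Set (Eucl d)} (hC : Convex ℝ C) (hPC : P Cᶜ = 0) :
    ∃ x₀ : Eucl d, ∃ ρ : ℝ, 0 < ρ ∧ Metric.ball x₀ ρ ⊆ C := by
  obtain ⟨s, x₀, ρ, hρ, hs, h⟩ := hP.exists_finset hd
  refine ⟨x₀, ρ, hρ, h C hC fun A hA => ?_⟩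
  by_contra hne
  exact (hs A hA).2.ne' (measure_mono_null (fun y hy hy' => hne ⟨y, hy', hy⟩) hPC)

/-! ### Hypographical convergence -/

/-- Convergence of functions in the sense of hypographs. -/
structure HypoLim {d : ℕ} (F : ℕ → Eucl d → ℝ) (f : Eucl d → ℝ) : Prop where
  upper : ∀ x c, f x < c → ∀ᶠ p in atTop ×ˢ 𝓝 x, F p.1 p.2 < c
  lower : ∀ x c, c < f x → ∀ U ∈ 𝓝 x, ∀ᶠ k in atTop, ∃ y ∈ U, c < F k y

/-- Uniformly bounded sequences of functions have hypographically convergent subsequences. -/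
theorem exists_subseq_hypoLim {d : ℕ} {F : ℕ → Eucl d → ℝ} (hF0 : ∀ k x, 0 ≤ F k x) {B : ℝ}
    (hFB : ∀ k x, F k x ≤ B) :
    ∃ φ : ℕ → ℕ, StrictMono φ ∧ ∃ f : Eucl d → ℝ, (∀ x, 0 ≤ f x) ∧ (∀ x, f x ≤ B) ∧
      HypoLim (fun k => F (φ k)) f := by
  have hB : 0 ≤ B := (hF0 0 0).trans (hFB 0 0)
  let b := TopologicalSpace.countableBasis (Eucl d)
  have hb : TopologicalSpace.IsTopologicalBasis b :=
    TopologicalSpace.isBasis_countableBasis (Eucl d)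
  have : Countable b := (TopologicalSpace.countable_countableBasis (Eucl d)).to_subtype
  -- Suprema over countably many basic open sets live in a sequentially compact product. The limit
  -- function takes the infimum of the limiting suprema over basic neighbourhoods.
  let s : ℕ → b → ENNReal := fun k U => ⨆ y ∈ (U : Set (Eucl d)), ENNReal.ofReal (F k y)
  obtain ⟨S, φ, hφ, hS⟩ := CompactSpace.tendsto_subseq s
  have hS' : ∀ U, Tendsto (fun k => s (φ k) U) atTop (𝓝 (S U)) := tendsto_pi_nhds.1 hS
  have hSB : ∀ U, S U ≤ ENNReal.ofReal B := fun U =>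
    le_of_tendsto' (hS' U) fun k => iSup₂_le fun y _ => ENNReal.ofReal_le_ofReal (hFB _ y)
  let G : Eucl d → ENNReal := fun x => ⨅ U : {U : b // x ∈ (U : Set (Eucl d))}, S U
  have hGB : ∀ x, G x ≤ ENNReal.ofReal B := by
    intro x
    obtain ⟨U, hU, hxU, -⟩ := hb.exists_subset_of_mem_open (Set.mem_univ x) isOpen_univ
    exact (iInf_le _ (⟨⟨U, hU⟩, hxU⟩ : {U : b // x ∈ (U : Set (Eucl d))})).trans (hSB _)
  have hGtop : ∀ x, G x ≠ ⊤ := fun x => ne_top_of_le_ne_top ENNReal.ofReal_ne_top (hGB x)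
  refine ⟨φ, hφ, fun x => (G x).toReal, fun x => ENNReal.toReal_nonneg,
    fun x => ENNReal.toReal_le_of_le_ofReal hB (hGB x), ?_, ?_⟩
  · intro x c hc
    have h1 : G x < ENNReal.ofReal c := (ENNReal.lt_ofReal_iff_toReal_lt (hGtop x)).2 hc
    obtain ⟨⟨U, hxU⟩, hU⟩ := iInf_lt_iff.1 h1
    have h2 := (hS' U).eventually_lt_const hU
    have hUx : (U : Set (Eucl d)) ∈ 𝓝 x := (hb.isOpen U.2).mem_nhds hxU
    filter_upwards [h2.prod_mk hUx] with p hp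
    refine (ENNReal.ofReal_lt_ofReal_iff_of_nonneg (hF0 _ _)).1 (lt_of_le_of_lt ?_ hp.1)
    exact le_iSup₂ (f := fun y _ => ENNReal.ofReal (F (φ p.1) y)) p.2 hp.2
  · intro x c hc U hU
    rcases lt_or_ge c 0 with h | h
    · exact Eventually.of_forall fun k => ⟨x, mem_of_mem_nhds hU, h.trans_le (hF0 _ _)⟩
    obtain ⟨V, hV, hxV, hVU⟩ := hb.mem_nhds_iff.1 hU
    have h1 : ENNReal.ofReal c < S ⟨V, hV⟩ :=
      ((ENNReal.ofReal_lt_iff_lt_toReal h (hGtop x)).2 hc).trans_le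
        (iInf_le _ (⟨⟨V, hV⟩, hxV⟩ : {U : b // x ∈ (U : Set (Eucl d))}))
    filter_upwards [(hS' ⟨V, hV⟩).eventually_const_lt h1] with k hk
    simp only [s, lt_iSup_iff] at hk
    obtain ⟨y, hy, hlt⟩ := hk
    exact ⟨y, hVU hy, (ENNReal.ofReal_lt_ofReal_iff_of_nonneg h).1 hlt⟩

namespace HypoLim

variable {d : ℕ} {F : ℕ → Eucl d → ℝ} {f : Eucl d → ℝ}

theorem eventually_lt (h : HypoLim F f) {x : Eucl d} {c : ℝ} (hc : f x < c) :
    ∀ᶠ k in atTop, F k x < c :=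
  (h.upper x c hc).curry.mono fun _ hk => hk.self_of_nhds

theorem exists_nhds (h : HypoLim F f) {x : Eucl d} {c : ℝ} (hc : f x < c) :
    ∃ U ∈ 𝓝 x, ∀ᶠ k in atTop, ∀ y ∈ U, F k y < c := by
  obtain ⟨A, hA, U, hU, hsub⟩ := mem_prod_iff.1 (h.upper x c hc)
  exact ⟨U, hU, mem_of_superset hA fun k hk y hy => hsub (Set.mk_mem_prod hk hy)⟩

theorem upperSemicontinuous (h : HypoLim F f) : UpperSemicontinuous f := by
  intro x c hc
  obtain ⟨c', hc', hcc'⟩ := exists_between hc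
  obtain ⟨U, hU, hk⟩ := h.exists_nhds hc'
  filter_upwards [eventually_mem_nhds_iff.2 hU] with y hy
  by_contra! hle
  obtain ⟨k, h1, z, hz, h2⟩ := (hk.and (h.lower y c' (hcc'.trans_le hle) U hy)).exists
  exact lt_asymm h2 (h1 z hz)

theorem logConcave (h : HypoLim F f) (hf : ∀ x, 0 ≤ f x) (hF : ∀ k, LogConcave (F k)) :
    LogConcave f := by
  intro x y a b ha hb hab
  by_contra! hlt
  have hfx : 0 < f x := by
    refine (hf x).lt_of_ne' fun h0 => ?_
    rw [h0, Real.zero_rpow ha.ne', zero_mul] at hlt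
    exact not_lt.2 (hf _) hlt
  have hfy : 0 < f y := by
    refine (hf y).lt_of_ne' fun h0 => ?_
    rw [h0, Real.zero_rpow hb.ne', mul_zero] at hlt
    exact not_lt.2 (hf _) hlt
  set q := f x ^ a * f y ^ b with hq
  have hqpos : 0 < q := by positivity
  -- Scaling both values by `r < 1` leaves room to pick nearby points by `lower`. As `a + b = 1`,
  -- the weighted product scales by exactly `r`.
  obtain ⟨r, hr0, hr1⟩ := exists_between ((div_lt_one hqpos).2 hlt)
  have hrpos : 0 < r := lt_of_le_of_lt (by have := hf (a • x + b • y); positivity) hr0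
  obtain ⟨W, hW, hk⟩ := h.exists_nhds ((div_lt_iff₀ hqpos).1 hr0)
  have hcont : Tendsto (fun p : Eucl d × Eucl d => a • p.1 + b • p.2) (𝓝 x ×ˢ 𝓝 y)
      (𝓝 (a • x + b • y)) := by
    rw [← nhds_prod_eq]
    exact (Continuous.tendsto (by fun_prop) (x, y))
  obtain ⟨U, hU, V, hV, hUV⟩ := mem_prod_iff.1 (hcont hW)
  obtain ⟨k, h1, ⟨x', hx', h2⟩, y', hy', h3⟩ := (hk.and
    ((h.lower x (r * f x) (by nlinarith) U hU).and
      (h.lower y (r * f y) (by nlinarith) V hV))).exists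
  have h4 := h1 _ (hUV (Set.mk_mem_prod hx' hy'))
  have h5 := (hF k).le_of_le ha hb hab (by positivity) (by positivity) h2.le h3.le
  rw [Real.mul_rpow hrpos.le hfx.le, Real.mul_rpow hrpos.le hfy.le] at h5
  have h6 : r ^ a * r ^ b = r := by rw [← Real.rpow_add hrpos, hab, Real.rpow_one]
  have h7 : r ^ a * f x ^ a * (r ^ b * f y ^ b) = r * q := by
    rw [hq]; nth_rewrite 3 [← h6]; ring
  rw [h7] at h5
  exact not_lt.2 h5 h4

/-- The upper bound is immediate. For the lower one, `F k` exceeds `c` at points near `x` in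
finitely many surrounding directions, and convexity of its superlevel set puts `x` inside. -/
theorem tendsto_of_mem_interior (h : HypoLim F f) (hd : 1 ≤ d) (hf : LogConcave f)
    (hF : ∀ k, LogConcave (F k)) {x : Eucl d} (hx : x ∈ interior {x | 0 < f x}) :
    Tendsto (fun k => F k x) atTop (𝓝 (f x)) := by
  have hsupp : interior {x | 0 < f x} ⊆ {x | 0 < f x} := interior_subset
  have hfx : 0 < f x := hsupp hx
  refine tendsto_order.2 ⟨fun c' hc' => ?_, fun c hc => h.eventually_lt hc⟩
  obtain ⟨c, hc, hcx⟩ := exists_between (max_lt hc' hfx)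
  have hc0 : 0 < c := (le_max_right _ _).trans_lt hc
  have hcont : ContinuousAt f x :=
    (hf.continuousOn hf.convex_support.interior isOpen_interior
      fun y hy => hsupp hy).continuousAt (isOpen_interior.mem_nhds hx)
  obtain ⟨ρ, hρ, hsub⟩ := Metric.eventually_nhds_iff.1 (hcont.eventually_const_lt hcx)
  obtain ⟨s, r, hr, hs⟩ := exists_finset_forall_ball_subset hd x
    (fun u : {u : Eucl d // ‖u‖ = 1} => Metric.ball (x + (ρ / 2) • (u : Eucl d)) (ρ / 4)) (by
      intro u hu
      refine ⟨⟨u, hu⟩, ρ / 4, by positivity, ρ, fun y hy => ?_⟩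
      rw [mem_ball_iff_norm] at hy
      have hsplit : y - x = (y - (x + (ρ / 2) • u)) + (ρ / 2) • u := by abel
      have hn : ‖(ρ / 2) • u‖ = ρ / 2 := by
        rw [norm_smul, hu, mul_one, Real.norm_of_nonneg (by positivity)]
      constructor
      · rw [hsplit]
        exact (norm_add_le _ _).trans (by rw [hn]; linarith)
      · rw [hsplit, inner_add_right, real_inner_smul_right, real_inner_self_eq_norm_sq, hu]
        have := (abs_le.1 (abs_real_inner_le_norm u (y - (x + (ρ / 2) • u)))).1
        rw [hu] at this
        linarith)
  have hev : ∀ᶠ k in atTop, ∀ u ∈ s,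
      ∃ y ∈ Metric.ball (x + (ρ / 2) • (u : Eucl d)) (ρ / 4), c < F k y := by
    rw [Filter.eventually_all_finset]
    intro u _
    refine h.lower (x + (ρ / 2) • (u : Eucl d)) c (hsub ?_) _ (Metric.ball_mem_nhds _ (by positivity))
    rw [dist_eq_norm, add_sub_cancel_left, norm_smul, u.2, Real.norm_of_nonneg (by positivity)]
    linarith
  filter_upwards [hev] with k hk
  have hball := hs {y | c ≤ F k y} ((hF k).convex_superlevel hc0) fun u hu => by
    obtain ⟨y, hy, hlt⟩ := hk u hu
    exact ⟨y, hlt.le, hy⟩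
  have hmem : x ∈ {y | c ≤ F k y} := hball (Metric.mem_ball_self hr)
  exact (le_max_left _ _).trans_lt (hc.trans_le hmem)

/-- Only the frontier of the convex support is lost, and it is null. Where `f` vanishes, the upper
bound and nonnegativity suffice. -/
theorem ae_tendsto (h : HypoLim F f) (hd : 1 ≤ d) (hf0 : ∀ x, 0 ≤ f x) (hF0 : ∀ k x, 0 ≤ F k x)
    (hf : LogConcave f) (hF : ∀ k, LogConcave (F k)) :
    ∀ᵐ x : Eucl d, Tendsto (fun k => F k x) atTop (𝓝 (f x)) := by
  have hnull := hf.convex_support.addHaar_frontier (volume : Measure (Eucl d))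
  filter_upwards [compl_mem_ae_iff.2 hnull] with x hx
  by_cases hpos : 0 < f x
  · refine h.tendsto_of_mem_interior hd hf hF ?_
    by_contra hint
    exact hx ⟨subset_closure hpos, hint⟩
  · have h0 : f x = 0 := le_antisymm (not_lt.1 hpos) (hf0 x)
    rw [h0]
    exact tendsto_order.2 ⟨fun c hc => Eventually.of_forall fun k => hc.trans_le (hF0 k x),
      fun c hc => h.eventually_lt (h0 ▸ hc)⟩

end HypoLim

/-! ### Semicontinuity of the likelihood and compactness -/

/-- Lower semicontinuity of the integral under simultaneous weak convergence of the measures and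
lower hypographical convergence of the integrands. -/
theorem lintegral_le_liminf_of_tendsto {E : Type*} [PseudoEMetricSpace E] [MeasurableSpace E]
    [BorelSpace E] {Q : ℕ → ProbabilityMeasure E} {P : ProbabilityMeasure E}
    (hQ : Tendsto Q atTop (𝓝 P)) {L : ℕ → E → ENNReal} {l : E → ENNReal}
    (h : ∀ x, ∀ c < l x, ∃ U ∈ 𝓝 x, ∀ᶠ k in atTop, ∀ y ∈ U, c < L k y) :
    ∫⁻ x, l x ∂(P : Measure E) ≤ liminf (fun k => ∫⁻ x, L k x ∂(Q k : Measure E)) atTop := by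
  -- Truncated Lipschitz minorants: `g m` is `m`-Lipschitz, at most `m`, increasing in `m`, and
  -- below `L k` for all `k ≥ m`. Weak convergence handles each, and monotone convergence recovers
  -- `l`.
  let g : ℕ → E → ENNReal := fun m x =>
    ⨅ k : Set.Ici m, ⨅ y, (min (L k y) m + m * edist x y)
  have hgm : ∀ m x, g m x ≤ m := fun m x =>
    (iInf₂_le ⟨m, Set.mem_Ici.2 le_rfl⟩ x).trans (by simp)
  have hgL : ∀ m k x, m ≤ k → g m x ≤ L k x := fun m k x hmk =>
    (iInf₂_le ⟨k, Set.mem_Ici.2 hmk⟩ x).trans (by simp)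
  have hgc : ∀ m, Continuous (g m) := by
    refine fun m => continuous_of_le_add_edist m (ENNReal.natCast_ne_top m) fun x x' => ?_
    simp only [g]
    rw [ENNReal.iInf_add]
    refine le_iInf fun k => ?_
    rw [ENNReal.iInf_add]
    refine le_iInf fun y => (iInf₂_le k y).trans ?_
    rw [add_assoc, ← mul_add]
    gcongr
    rw [add_comm]
    exact edist_triangle x x' y
  have hmono : Monotone g := by
    intro m m' hmm' x
    refine le_iInf fun k => le_iInf fun y => ?_
    refine (iInf₂_le ⟨k, Set.mem_Ici.2 (hmm'.trans k.2)⟩ y).trans ?_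
    gcongr
  have hsup : ∀ x, l x ≤ ⨆ m, g m x := by
    intro x
    refine le_of_forall_lt fun c hc => ?_
    obtain ⟨c', hcc', hc'⟩ := exists_between hc
    have hc'top : c' ≠ ⊤ := (hc'.trans_le le_top).ne
    obtain ⟨U, hU, hk⟩ := h x c' hc'
    obtain ⟨K, hK⟩ := eventually_atTop.1 hk
    obtain ⟨ε, hε, hball⟩ := EMetric.mem_nhds_iff.1 hU
    obtain ⟨N, hN⟩ := ENNReal.exists_nat_mul_gt hε.ne' hc'top
    obtain ⟨N', hN'⟩ := ENNReal.exists_nat_gt hc'top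
    refine lt_of_lt_of_le hcc' (le_iSup_of_le (max K (max N N')) ?_)
    refine le_iInf fun k => le_iInf fun y => ?_
    by_cases hy : y ∈ U
    · refine le_add_right (le_min (hK k ((le_max_left _ _).trans k.2) y hy).le (hN'.le.trans ?_))
      exact_mod_cast (le_max_right N N').trans (le_max_right _ _)
    · have h1 : ε ≤ edist x y := by
        by_contra! hlt
        exact hy (hball (by rwa [Metric.mem_eball, edist_comm]))
      refine le_add_left (hN.le.trans ?_)
      gcongr
      exact (le_max_left N N').trans (le_max_right _ _)
  calc ∫⁻ x, l x ∂(P : Measure E) ≤ ∫⁻ x, ⨆ m, g m x ∂(P : Measure E) := lintegral_mono hsup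
    _ = ⨆ m, ∫⁻ x, g m x ∂(P : Measure E) :=
      lintegral_iSup (fun m => (hgc m).measurable) hmono
    _ ≤ _ := iSup_le fun m => ?_
  have hfin : ∀ x, g m x ≠ ⊤ := fun x => ne_top_of_le_ne_top (ENNReal.natCast_ne_top m) (hgm m x)
  have hcont : Continuous fun x => (g m x).toNNReal :=
    continuous_iff_continuousAt.2 fun x =>
      (ENNReal.tendsto_toNNReal (hfin x)).comp (hgc m).continuousAt
  have hreal : ∀ x, ((g m x).toNNReal : ℝ) ≤ m := fun x => by
    have := ENNReal.toReal_mono (ENNReal.natCast_ne_top m) (hgm m x)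
    rwa [ENNReal.toReal_natCast] at this
  let G : BoundedContinuousFunction E NNReal := BoundedContinuousFunction.mkOfBound
    ⟨_, hcont⟩ m fun x y => by
      rw [NNReal.dist_eq]
      exact abs_sub_le_of_nonneg_of_le NNReal.zero_le_coe (hreal x) NNReal.zero_le_coe (hreal y)
  have hG : ∀ x, (G x : ENNReal) = g m x := fun x => ENNReal.coe_toNNReal (hfin x)
  have ht := ProbabilityMeasure.tendsto_iff_forall_lintegral_tendsto.1 hQ G
  simp only [hG] at ht
  rw [← ht.liminf_eq]
  refine liminf_le_liminf ?_
  filter_upwards [eventually_ge_atTop m] with k hk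
  exact lintegral_mono fun x => hgL m k x hk

/-- Turns the upper half of hypographical convergence of densities into the local lower bound on
costs needed by `lintegral_le_liminf_of_tendsto`. -/
theorem lt_cost_iff {M t : ℝ} {c : ENNReal} (hc : c ≠ ⊤) :
    c < cost M t ↔ t < Real.exp (M - c.toReal) := by
  rcases le_or_gt t 0 with h | h
  · rw [cost_of_nonpos h]
    exact iff_of_true hc.lt_top (h.trans_lt (Real.exp_pos _))
  · rw [cost_of_pos h, ENNReal.lt_ofReal_iff_toReal_lt hc, ← Real.log_lt_iff_lt_exp h,
      lt_sub_comm]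

/-- Compactness of log-concave densities with bounded below log-likelihood under a weakly
convergent sequence of probability measures. -/
theorem exists_subseq_density {d : ℕ} (hd : 1 ≤ d) {Q : ℕ → ProbabilityMeasure (Eucl d)}
    {P : ProbabilityMeasure (Eucl d)} (hP : InClassP (P : Measure (Eucl d)))
    (hQ : Tendsto Q atTop (𝓝 P)) {F : ℕ → Eucl d → ℝ} (hF : ∀ k, IsLogConcaveDensity (F k))
    {c : ℝ} (hc : ∀ᶠ k in atTop, (c : EReal) ≤ extIntegral (logFun (F k)) (Q k)) :
    ∃ φ : ℕ → ℕ, StrictMono φ ∧ ∃ f : Eucl d → ℝ, IsLogConcaveDensity f ∧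
      HypoLim (fun k => F (φ k)) f ∧
      (∃ x₀ : Eucl d, ∃ t M : ℝ, ∀ k, Real.exp t ≤ F (φ k) x₀ ∧ ∀ x, F (φ k) x ≤ Real.exp M) ∧
      ∀ c' : ℝ, (∀ᶠ k in atTop, (c' : EReal) ≤ extIntegral (logFun (F (φ k))) (Q (φ k))) →
        (c' : EReal) ≤ extIntegral (logFun f) P := by
  obtain ⟨s, x₀, ρ, hρ, hs, hball⟩ := hP.exists_finset hd
  -- The inequality is strict so that, by the portmanteau theorem for open sets, `Q k` eventually
  -- gives these sets mass at least `η`.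
  obtain ⟨η, hη, hη0, hη1⟩ : ∃ η : ℝ, (∀ A ∈ s, ENNReal.ofReal η < (P : Measure (Eucl d)) A) ∧
      0 < η ∧ η < 1 := by
    have h1 : ∀ᶠ η in 𝓝[>] (0 : ℝ), ∀ A ∈ s, ENNReal.ofReal η < (P : Measure (Eucl d)) A := by
      rw [Filter.eventually_all_finset]
      intro A hA
      have : Tendsto ENNReal.ofReal (𝓝[>] 0) (𝓝 0) := by
        simpa using (ENNReal.continuous_ofReal.tendsto 0).mono_left nhdsWithin_le_nhds
      exact this.eventually_lt_const (hs A hA).2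
    exact (h1.and (Ioo_mem_nhdsGT zero_lt_one)).exists
  have hev : ∀ᶠ k in atTop, ∀ A ∈ s, ENNReal.ofReal η ≤ (Q k : Measure (Eucl d)) A := by
    rw [Filter.eventually_all_finset]
    intro A hA
    have h1 := (hη A hA).trans_le
      (ProbabilityMeasure.le_liminf_measure_open_of_tendsto hQ (hs A hA).1)
    exact (eventually_lt_of_lt_liminf h1).mono fun k hk => hk.le
  obtain ⟨K, hK⟩ := eventually_atTop.1 (hev.and hc)
  obtain ⟨M, t, hMt⟩ := exists_uniform_bounds s x₀ hρ hball hη0 hη1 c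
  have hMt' : ∀ k, _ := fun k => hMt (Q (k + K)) inferInstance (hK (k + K) (by omega)).1
    (F (k + K)) (hF _) (hK (k + K) (by omega)).2
  obtain ⟨ψ, hψ, f, hf0, hfM, hlim⟩ := exists_subseq_hypoLim (F := fun k => F (k + K))
    (fun k => (hF _).nonneg) (fun k => (hMt' k).1)
  let φ : ℕ → ℕ := fun k => ψ k + K
  have hφ : StrictMono φ := fun i j hij => by
    have := hψ hij
    simp only [φ]; omega
  have hφK : ∀ k, _ := fun k => hMt' (ψ k)
  have hflc : LogConcave f := hlim.logConcave hf0 fun k => (hF _).logConcave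
  obtain ⟨a, b, hb, henv⟩ := exists_envelope x₀ hρ t M
  have hfint : ∫⁻ x, ENNReal.ofReal (f x) = 1 := by
    have h1 := tendsto_lintegral_of_dominated_convergence (μ := (volume : Measure (Eucl d)))
      (F := fun k x => ENNReal.ofReal (F (φ k) x)) (f := fun x => ENNReal.ofReal (f x))
      (fun x => ENNReal.ofReal (Real.exp (a - b * ‖x‖)))
      (fun k => (hF _).measurable.ennreal_ofReal)
      (fun k => Eventually.of_forall fun x => ENNReal.ofReal_le_ofReal
        (henv _ (hF _) (hφK k).2 (hφK k).1 x))
      (lintegral_exp_sub_norm_lt_top a hb).ne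
      ((hlim.ae_tendsto hd hf0 (fun k => (hF _).nonneg) hflc fun k => (hF _).logConcave).mono
        fun x hx => (ENNReal.continuous_ofReal.tendsto _).comp hx)
    simp only [(hF _).lintegral_eq_one] at h1
    exact (tendsto_nhds_unique h1 tendsto_const_nhds)
  have hf : IsLogConcaveDensity f :=
    ⟨hf0, hlim.upperSemicontinuous, (isConcave_logFun_iff hf0).2 hflc, hfint⟩
  refine ⟨φ, hφ, f, hf, hlim, ⟨x₀, t, M, fun k =>
    ⟨(hφK k).2 x₀ (Metric.mem_ball_self hρ), (hφK k).1⟩⟩, fun c' hc' => ?_⟩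
  have hiff : ∀ k, _ := fun k =>
    le_extIntegral_iff (Q (φ k) : Measure (Eucl d)) (hF (φ k)).measurable (hφK k).1 (c := c')
  have hc'' := hc'.mono fun k hk => (hiff k).1 hk
  rw [le_extIntegral_iff _ hf.measurable hfM]
  obtain ⟨k, hk⟩ := hc''.exists
  refine ⟨hk.1, ?_⟩
  have hlsc := lintegral_le_liminf_of_tendsto (hQ.comp hφ.tendsto_atTop)
    (L := fun k x => cost M (F (φ k) x)) (l := fun x => cost M (f x)) (by
      intro x c₁ hc₁
      have hc₁top : c₁ ≠ ⊤ := (hc₁.trans_le le_top).ne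
      obtain ⟨U, hU, hUk⟩ := hlim.exists_nhds ((lt_cost_iff hc₁top).1 hc₁)
      exact ⟨U, hU, hUk.mono fun k hk y hy => (lt_cost_iff hc₁top).2 (hk y hy)⟩)
  exact hlsc.trans (liminf_le_of_frequently_le' (hc''.mono fun k hk => hk.2).frequently)

/-! ### Existence and uniqueness of the maximiser -/

/-- There is a log-concave density with finite log-likelihood under every measure with finite first
moment. -/
theorem InClassP.exists_density {d : ℕ} {P : Measure (Eucl d)} (hP : InClassP P) :
    ∃ g : Eucl d → ℝ, IsLogConcaveDensity g ∧
      ∃ c : ℝ, (c : EReal) ≤ extIntegral (logFun g) P := by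
  have := hP.isProbabilityMeasure
  set K := ∫⁻ x : Eucl d, ENNReal.ofReal (Real.exp (-‖x‖)) with hK
  have hKtop : K ≠ ⊤ := by
    have := lintegral_exp_sub_norm_lt_top (d := d) 0 one_pos
    simpa using this.ne
  have hK0 : K ≠ 0 := by
    rw [hK, ← pos_iff_ne_zero, lintegral_pos_iff_support (by fun_prop)]
    have : Function.support (fun x : Eucl d => ENNReal.ofReal (Real.exp (-‖x‖))) = Set.univ := by
      ext x; simp [Real.exp_pos]
    rw [this]
    exact isOpen_univ.measure_pos volume Set.univ_nonempty
  have hKpos : 0 < K.toReal := ENNReal.toReal_pos hK0 hKtop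
  set M := -Real.log K.toReal with hM
  have hg0 : ∀ x : Eucl d, 0 ≤ Real.exp (M - ‖x‖) := fun x => (Real.exp_pos _).le
  have hg : IsLogConcaveDensity (fun x : Eucl d => Real.exp (M - ‖x‖)) := by
    refine ⟨hg0, Continuous.upperSemicontinuous (by fun_prop), (isConcave_logFun_iff hg0).2 ?_, ?_⟩
    · intro x y a b ha hb hab
      rw [← Real.exp_mul, ← Real.exp_mul, ← Real.exp_add, Real.exp_le_exp]
      have h1 : ‖a • x + b • y‖ ≤ a * ‖x‖ + b * ‖y‖ := by
        refine (norm_add_le _ _).trans (le_of_eq ?_)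
        rw [norm_smul, norm_smul, Real.norm_of_nonneg ha.le, Real.norm_of_nonneg hb.le]
      have h2 : (M - ‖x‖) * a + (M - ‖y‖) * b = (a + b) * M - (a * ‖x‖ + b * ‖y‖) := by ring
      rw [h2, hab]
      linarith
    · have h1 : ∀ x : Eucl d, ENNReal.ofReal (Real.exp (M - ‖x‖)) =
          ENNReal.ofReal (Real.exp M) * ENNReal.ofReal (Real.exp (-‖x‖)) := fun x => by
        rw [← ENNReal.ofReal_mul (Real.exp_pos M).le, ← Real.exp_add, sub_eq_add_neg]
      rw [lintegral_congr h1, lintegral_const_mul _ (by fun_prop), ← hK, hM, Real.exp_neg,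
        Real.exp_log hKpos, ENNReal.ofReal_inv_of_pos hKpos, ENNReal.ofReal_toReal hKtop,
        ENNReal.inv_mul_cancel hK0 hKtop]
  set m := ∫⁻ x, ENNReal.ofReal ‖x‖ ∂P with hm
  refine ⟨_, hg, M - m.toReal, ?_⟩
  rw [le_extIntegral_iff P hg.measurable (M := M)
    (fun x => Real.exp_le_exp.2 (by linarith [norm_nonneg x]))]
  refine ⟨by linarith [ENNReal.toReal_nonneg (a := m)], ?_⟩
  rw [sub_sub_cancel, ENNReal.ofReal_toReal hP.finite_mean.ne]
  refine lintegral_mono fun x => ?_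
  rw [cost_of_pos (Real.exp_pos _), Real.log_exp, sub_sub_cancel]

theorem InClassP.exists_isMaximiser {d : ℕ} (hd : 1 ≤ d) {P : Measure (Eucl d)}
    (hP : InClassP P) : ∃ f : Eucl d → ℝ, IsMaximiser P f := by
  have := hP.isProbabilityMeasure
  obtain ⟨g, hg, c, hc⟩ := hP.exists_density
  set S : Set EReal := {v | ∃ h : Eucl d → ℝ, IsLogConcaveDensity h ∧
    v = extIntegral (logFun h) P} with hS
  obtain ⟨u, -, hu, huS⟩ := exists_seq_tendsto_sSup (S := S) ⟨_, g, hg, rfl⟩ (OrderTop.bddAbove S)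
  choose F hF huF using huS
  have hcS : (c : EReal) ≤ sSup S := hc.trans (le_sSup ⟨g, hg, rfl⟩)
  have hlt : ∀ r : ℝ, (r : EReal) < sSup S →
      ∀ᶠ k in atTop, (r : EReal) ≤ extIntegral (logFun (F k)) P := fun r hr =>
    (hu.eventually_const_lt hr).mono fun k hk => huF k ▸ hk.le
  have hc1 : ((c - 1 : ℝ) : EReal) < sSup S :=
    lt_of_lt_of_le (EReal.coe_lt_coe_iff.2 (by linarith)) hcS
  obtain ⟨φ, hφ, f, hf, -, -, hmax⟩ := exists_subseq_density hd (P := ⟨P, this⟩) hP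
    (Q := fun _ => ⟨P, this⟩) tendsto_const_nhds hF (hlt _ hc1)
  refine ⟨f, hf, fun h hh => (le_sSup (show _ ∈ S from ⟨h, hh, rfl⟩)).trans ?_⟩
  exact EReal.ge_of_forall_gt_iff_ge.1 fun r hr =>
    hmax r (hφ.tendsto_atTop.eventually (hlt r hr))

/-- If `g x < c < f x`, then `g < c` near `x` by semicontinuity. Log-concavity makes `f > c` on
small balls close to `x`, towards a ball where `f` is bounded below; these have positive volume. -/
theorem eq_of_ae_eq {d : ℕ} {f g : Eucl d → ℝ} (hf : IsLogConcaveDensity f)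
    (hg : IsLogConcaveDensity g) (h : f =ᵐ[volume] g) : f = g := by
  suffices H : ∀ f g : Eucl d → ℝ, IsLogConcaveDensity f → IsLogConcaveDensity g →
      f =ᵐ[volume] g → ∀ x, f x ≤ g x from
    funext fun x => le_antisymm (H f g hf hg h x) (H g f hg hf h.symm x)
  intro f g hf hg h x
  by_contra! hlt
  have hfx : 0 < f x := (hg.nonneg x).trans_lt hlt
  obtain ⟨x₀, ρ, hρ, t, ht⟩ := hf.exists_ball_exp_le
  obtain ⟨c, hgc, hcf⟩ := exists_between hlt
  have hc0 : 0 < c := (hg.nonneg x).trans_lt hgc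
  obtain ⟨ε, hε, hball⟩ := Metric.eventually_nhds_iff.1 (hg.usc x c hgc)
  set m := Real.log (f x) with hm
  have hev : ∀ᶠ l in 𝓝[>] (0 : ℝ), l * (‖x₀ - x‖ + ρ) < ε ∧
      Real.log c < (1 - l) * m + l * t ∧ l ∈ Set.Ioo (0 : ℝ) 1 := by
    refine Eventually.and ?_ (Eventually.and ?_ (Ioo_mem_nhdsGT zero_lt_one))
    · have : Tendsto (fun l : ℝ => l * (‖x₀ - x‖ + ρ)) (𝓝[>] 0) (𝓝 0) := by
        have : Continuous fun l : ℝ => l * (‖x₀ - x‖ + ρ) := by fun_prop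
        simpa using (this.tendsto 0).mono_left nhdsWithin_le_nhds
      exact this.eventually_lt_const hε
    · have : Tendsto (fun l : ℝ => (1 - l) * m + l * t) (𝓝[>] 0) (𝓝 m) := by
        have : Continuous fun l : ℝ => (1 - l) * m + l * t := by fun_prop
        simpa using (this.tendsto 0).mono_left nhdsWithin_le_nhds
      exact this.eventually_const_lt (Real.log_lt_log hc0 hcf)
  obtain ⟨l, hl1, hl2, hl0, hl01⟩ := hev.exists
  have hae : ∀ᵐ y : Eucl d, f y = g y := h
  obtain ⟨y, hy, hfg⟩ : ∃ y ∈ Metric.ball ((1 - l) • x + l • x₀) (l * ρ), f y = g y := by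
    by_contra! hcon
    have : volume (Metric.ball ((1 - l) • x + l • x₀) (l * ρ)) = 0 :=
      measure_mono_null (fun y hy => hcon y hy) (ae_iff.1 hae)
    exact (Metric.measure_ball_pos volume _ (mul_pos hl0 hρ)).ne' this
  set y' : Eucl d := x₀ + l⁻¹ • (y - ((1 - l) • x + l • x₀)) with hy'
  have hmem : y' ∈ Metric.ball x₀ ρ := by
    rw [mem_ball_iff_norm] at hy ⊢
    rw [hy', add_sub_cancel_left, norm_smul, norm_inv, Real.norm_of_nonneg hl0.le,
      inv_mul_lt_iff₀ hl0]
    exact hy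
  have heq : (1 - l) • x + l • y' = y := by
    rw [hy', smul_add, smul_smul, mul_inv_cancel₀ hl0.ne', one_smul]; abel
  have h1 := hf.logConcave.exp_le (by linarith) hl0 (by ring) (Real.exp_log hfx).le (ht _ hmem)
    (a := 1 - l)
  rw [heq, hfg] at h1
  have h2 : g y < c := by
    refine hball ?_
    rw [← heq, dist_eq_norm]
    have h3 : (1 - l) • x + l • y' - x = l • (y' - x) := by module
    rw [h3, norm_smul, Real.norm_of_nonneg hl0.le]
    refine lt_of_le_of_lt ?_ hl1
    gcongr
    have h4 : y' - x = (x₀ - x) + (y' - x₀) := by abel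
    rw [h4]
    exact (norm_add_le _ _).trans (by gcongr; exact (mem_ball_iff_norm.1 hmem).le)
  have h3 : c < g y := by
    rw [← Real.exp_log hc0]
    exact (Real.exp_lt_exp.2 hl2).trans_le h1
  exact lt_asymm h2 h3

/-- The geometric mean `√(f g)` is log-concave and has likelihood at least the common value.
Normalising adds `-log c` with `c = ∫ √(f g)`, so maximality forces `c ≥ 1`, and the Hellinger
distance `2 - 2 c` vanishes. -/
theorem InClassP.isMaximiser_unique {d : ℕ} (hd : 1 ≤ d) {P : Measure (Eucl d)}
    (hP : InClassP P) {f g : Eucl d → ℝ} (hf : IsMaximiser P f) (hg : IsMaximiser P g) :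
    f = g := by
  have := hP.isProbabilityMeasure
  refine eq_of_ae_eq hf.1 hg.1 ?_
  obtain ⟨M₁, hM₁⟩ := hf.1.exists_le_exp
  obtain ⟨M₂, hM₂⟩ := hg.1.exists_le_exp
  set M := max M₁ M₂
  have hfM : ∀ x, f x ≤ Real.exp M := fun x =>
    (hM₁ x).trans (Real.exp_le_exp.2 (le_max_left _ _))
  have hgM : ∀ x, g x ≤ Real.exp M := fun x =>
    (hM₂ x).trans (Real.exp_le_exp.2 (le_max_right _ _))
  have hvalue : extIntegral (logFun f) P = extIntegral (logFun g) P :=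
    le_antisymm (hg.2 f hf.1) (hf.2 g hg.1)
  obtain ⟨e, he, c₀, hc₀⟩ := hP.exists_density
  have hcf : ∫⁻ x, cost M (f x) ∂P ≠ ⊤ := ne_top_of_le_ne_top ENNReal.ofReal_ne_top
    ((le_extIntegral_iff P hf.1.measurable hfM).1 (hc₀.trans (hf.2 e he))).2
  have hcg : ∫⁻ x, cost M (g x) ∂P ≠ ⊤ := ne_top_of_le_ne_top ENNReal.ofReal_ne_top
    ((le_extIntegral_iff P hg.1.measurable hgM).1 (hc₀.trans (hg.2 e he))).2
  set I := (∫⁻ x, cost M (f x) ∂P).toReal with hI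
  have hfI : ∫⁻ x, cost M (f x) ∂P = ENNReal.ofReal I := (ENNReal.ofReal_toReal hcf).symm
  have hval : extIntegral (logFun f) P = ((M - I : ℝ) : EReal) := by
    rw [extIntegral_logFun_eq P hf.1.measurable hfM, ← EReal.coe_ennreal_toReal hcf, EReal.coe_sub]
  have hgI : ∫⁻ x, cost M (g x) ∂P ≤ ENNReal.ofReal I := by
    have h1 := ((le_extIntegral_iff P hg.1.measurable hgM).1 (hval ▸ hvalue).le).2
    rwa [sub_sub_cancel] at h1
  set q : Eucl d → ℝ := fun x => √(f x * g x) with hq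
  have hq0 : ∀ x, 0 ≤ q x := fun x => Real.sqrt_nonneg _
  have hqm : Measurable q := (hf.1.measurable.mul hg.1.measurable).sqrt
  have hqlc : LogConcave q := by
    intro x y a b ha hb hab
    have hf' := hf.1.logConcave x y a b ha hb hab
    have hg' := hg.1.logConcave x y a b ha hb hab
    have h1 : q x ^ a * q y ^ b = √((f x ^ a * f y ^ b) * (g x ^ a * g y ^ b)) := by
      have hx := hf.1.nonneg x
      have hy := hf.1.nonneg y
      have hx' := hg.1.nonneg x
      have hy' := hg.1.nonneg y
      simp only [hq, Real.sqrt_eq_rpow]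
      rw [← Real.rpow_mul (by positivity), ← Real.rpow_mul (by positivity), mul_comm _ a,
        mul_comm _ b, Real.rpow_mul (by positivity), Real.rpow_mul (by positivity),
        ← Real.mul_rpow (by positivity) (by positivity), Real.mul_rpow hx hx',
        Real.mul_rpow hy hy']
      congr 1; ring
    rw [h1]
    refine Real.sqrt_le_sqrt (mul_le_mul hf' hg' ?_ (hf.1.nonneg _))
    exact mul_nonneg (Real.rpow_nonneg (hg.1.nonneg _) _) (Real.rpow_nonneg (hg.1.nonneg _) _)
  have hqM : ∀ x, q x ≤ Real.exp M := fun x => by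
    rw [hq]
    refine Real.sqrt_le_iff.2 ⟨(Real.exp_pos M).le, ?_⟩
    rw [sq]
    exact mul_le_mul (hfM x) (hgM x) (hg.1.nonneg x) (Real.exp_pos M).le
  have hqusc : UpperSemicontinuous q := by
    intro x r hr
    have hcont : Tendsto (fun δ : ℝ => √((f x + δ) * (g x + δ))) (𝓝[>] 0) (𝓝 (q x)) := by
      have : Continuous fun δ : ℝ => √((f x + δ) * (g x + δ)) := by fun_prop
      simpa using (this.tendsto 0).mono_left nhdsWithin_le_nhds
    obtain ⟨δ, hδr, hδ⟩ := ((hcont.eventually_lt_const hr).and self_mem_nhdsWithin).exists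
    have hδ0 : 0 < δ := hδ
    filter_upwards [hf.1.usc x _ (lt_add_of_pos_right (f x) hδ0),
      hg.1.usc x _ (lt_add_of_pos_right (g x) hδ0)] with y hy hy'
    refine lt_of_le_of_lt (Real.sqrt_le_sqrt (mul_le_mul hy.le hy'.le (hg.1.nonneg y) ?_)) hδr
    linarith [hf.1.nonneg x]
  have hqcost : ∀ x, cost M (q x) = (cost M (f x) + cost M (g x)) / 2 := by
    intro x
    rcases (hf.1.nonneg x).eq_or_lt with h | h
    · simp [hq, ← h, cost_of_nonpos le_rfl, ENNReal.top_div]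
    rcases (hg.1.nonneg x).eq_or_lt with h' | h'
    · simp [hq, ← h', cost_of_nonpos le_rfl, ENNReal.top_div]
    have hlog : ∀ y : ℝ, 0 < y → y ≤ Real.exp M → Real.log y ≤ M := fun y hy hy' => by
      rw [← Real.log_exp M]; exact Real.log_le_log hy hy'
    rw [cost_of_pos h, cost_of_pos h', cost_of_pos (Real.sqrt_pos.2 (mul_pos h h')),
      ← ENNReal.ofReal_add (by linarith [hlog _ h (hfM x)]) (by linarith [hlog _ h' (hgM x)]),
      ← ENNReal.ofReal_ofNat, ← ENNReal.ofReal_div_of_pos two_pos,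
      Real.log_sqrt (mul_pos h h').le, Real.log_mul h.ne' h'.ne']
    congr 1; ring
  have hcq : ∫⁻ x, cost M (q x) ∂P ≤ ENNReal.ofReal I := by
    rw [lintegral_congr hqcost]
    simp only [div_eq_mul_inv]
    have hmf : Measurable fun x => cost M (f x) := (measurable_cost M).comp hf.1.measurable
    have hmg : Measurable fun x => cost M (g x) := (measurable_cost M).comp hg.1.measurable
    rw [lintegral_mul_const (f := fun x => cost M (f x) + cost M (g x)) _ (hmf.add hmg), lintegral_add_left hmf, ← div_eq_mul_inv]
    refine ENNReal.div_le_of_le_mul ?_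
    rw [mul_two, hfI]
    gcongr
  have hff : Integrable f := by
    refine ⟨hf.1.measurable.aestronglyMeasurable, ?_⟩
    rw [hasFiniteIntegral_iff_ofReal (Eventually.of_forall hf.1.nonneg), hf.1.lintegral_eq_one]
    exact ENNReal.one_lt_top
  have hgg : Integrable g := by
    refine ⟨hg.1.measurable.aestronglyMeasurable, ?_⟩
    rw [hasFiniteIntegral_iff_ofReal (Eventually.of_forall hg.1.nonneg), hg.1.lintegral_eq_one]
    exact ENNReal.one_lt_top
  have hf1 : ∫ x, f x = 1 := by
    rw [integral_eq_lintegral_of_nonneg_ae (Eventually.of_forall hf.1.nonneg) hff.1,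
      hf.1.lintegral_eq_one, ENNReal.toReal_one]
  have hg1 : ∫ x, g x = 1 := by
    rw [integral_eq_lintegral_of_nonneg_ae (Eventually.of_forall hg.1.nonneg) hgg.1,
      hg.1.lintegral_eq_one, ENNReal.toReal_one]
  have hsq : ∀ x, (√(f x) - √(g x)) ^ 2 = f x + g x - 2 * q x := fun x => by
    rw [sub_sq, Real.sq_sqrt (hf.1.nonneg x), Real.sq_sqrt (hg.1.nonneg x)]
    simp only [hq, Real.sqrt_mul (hf.1.nonneg x)]
    ring
  have hqq : Integrable q := by
    refine (hff.add hgg).mono' hqm.aestronglyMeasurable (Eventually.of_forall fun x => ?_)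
    rw [Real.norm_of_nonneg (hq0 x), Pi.add_apply]
    nlinarith [hsq x, sq_nonneg (√(f x) - √(g x)), hq0 x]
  set c := ∫ x, q x with hc
  have hsqint : ∫ x, (√(f x) - √(g x)) ^ 2 = 2 - 2 * c := by
    simp only [hsq]
    have h1 := integral_sub (f := fun x => f x + g x) (hff.add hgg) (hqq.const_mul 2)
    rw [h1, integral_add hff hgg, hf1, hg1, integral_const_mul]
    ring
  have hcpos : 0 < c := by
    have hae : ∀ᵐ x ∂P, 0 < f x ∧ 0 < g x := by
      filter_upwards [ae_lt_top ((measurable_cost M).comp hf.1.measurable) hcf,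
        ae_lt_top ((measurable_cost M).comp hg.1.measurable) hcg] with x h1 h2
      constructor
      · by_contra h
        exact h1.ne (cost_of_nonpos (not_lt.1 h))
      · by_contra h
        exact h2.ne (cost_of_nonpos (not_lt.1 h))
    -- Finite likelihoods make `f` and `g` positive `P`-almost everywhere, so the convex common
    -- support has full mass and contains a ball.
    obtain ⟨x₀, ρ, hρ, hsub⟩ := hP.exists_ball_subset hd
      (hf.1.logConcave.convex_support.inter hg.1.logConcave.convex_support) (ae_iff.1 hae)
    rw [hc, integral_pos_iff_support_of_nonneg hq0 hqq]
    refine (Metric.measure_ball_pos volume x₀ hρ).trans_le (measure_mono fun x hx => ?_)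
    exact (Real.sqrt_pos.2 (mul_pos (hsub hx).1 (hsub hx).2)).ne'
  have hc1 : 1 ≤ c := by
    have hh0 : ∀ x, 0 ≤ q x / c := fun x => div_nonneg (hq0 x) hcpos.le
    have hh : IsLogConcaveDensity fun x => q x / c := by
      refine ⟨hh0, (continuous_id.div_const c).comp_upperSemicontinuous hqusc
        fun _ _ hab => div_le_div_of_nonneg_right hab hcpos.le,
        (isConcave_logFun_iff hh0).2 fun x y a b ha hb hab => ?_, ?_⟩
      · rw [Real.div_rpow (hq0 x) hcpos.le, Real.div_rpow (hq0 y) hcpos.le, div_mul_div_comm,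
          ← Real.rpow_add hcpos, hab, Real.rpow_one]
        exact div_le_div_of_nonneg_right (hqlc x y a b ha hb hab) hcpos.le
      · rw [← ofReal_integral_eq_lintegral_ofReal (hqq.div_const c) (Eventually.of_forall hh0),
          integral_div, ← hc, div_self hcpos.ne', ENNReal.ofReal_one]
    have hhM : ∀ x, q x / c ≤ Real.exp (M - Real.log c) := fun x => by
      rw [Real.exp_sub, Real.exp_log hcpos]
      exact div_le_div_of_nonneg_right (hqM x) hcpos.le
    have hhcost : ∀ x, cost (M - Real.log c) (q x / c) = cost M (q x) := fun x => by
      rcases (hq0 x).eq_or_lt with h | h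
      · rw [← h, zero_div, cost_of_nonpos le_rfl, cost_of_nonpos le_rfl]
      · rw [cost_of_pos h, cost_of_pos (div_pos h hcpos), Real.log_div h.ne' hcpos.ne']
        congr 1; ring
    have hI0 : 0 ≤ I := ENNReal.toReal_nonneg
    have h1 : ((M - Real.log c - I : ℝ) : EReal) ≤ extIntegral (logFun fun x => q x / c) P := by
      rw [le_extIntegral_iff P hh.measurable hhM]
      refine ⟨by linarith, ?_⟩
      rw [sub_sub_cancel, lintegral_congr hhcost]
      exact hcq
    have h2 := h1.trans (hf.2 _ hh)
    rw [hval, EReal.coe_le_coe_iff] at h2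
    rw [← Real.log_nonneg_iff hcpos]
    linarith
  have hzero : ∫ x, (√(f x) - √(g x)) ^ 2 = 0 :=
    le_antisymm (by rw [hsqint]; linarith) (integral_nonneg fun x => sq_nonneg _)
  have hint : Integrable fun x => (√(f x) - √(g x)) ^ 2 := by
    simp only [hsq]
    exact (hff.add hgg).sub (hqq.const_mul 2)
  filter_upwards [(integral_eq_zero_iff_of_nonneg (fun x => sq_nonneg _) hint).1 hzero] with x hx
  have h1 : √(f x) - √(g x) = 0 := by simpa using hx
  exact (Real.sqrt_inj (hf.1.nonneg x) (hg.1.nonneg x)).1 (sub_eq_zero.1 h1)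

theorem InClassP.projWellDefined {d : ℕ} (hd : 1 ≤ d) {P : Measure (Eucl d)} (hP : InClassP P) :
    ProjWellDefined P := by
  obtain ⟨f, hf⟩ := hP.exists_isMaximiser hd
  exact ⟨hP, f, hf, fun g hg => hP.isMaximiser_unique hd hg hf⟩

theorem InClassP.isMaximiser_logConcaveProj {d : ℕ} (hd : 1 ≤ d) {P : Measure (Eucl d)}
    (hP : InClassP P) : IsMaximiser P (logConcaveProj P) := by
  have h := hP.exists_isMaximiser hd
  rw [logConcaveProj, dif_pos h]
  exact h.choose_spec

/-! ### Stability of the projection in weighted `L¹` -/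

theorem HypoLim.eventually_forall_lt_of_isCompact {d : ℕ} {F : ℕ → Eucl d → ℝ} {f : Eucl d → ℝ}
    (h : HypoLim F f) {K : Set (Eucl d)} (hK : IsCompact K) {c : ℝ} (hc : ∀ x ∈ K, f x < c) :
    ∀ᶠ k in atTop, ∀ x ∈ K, F k x < c := by
  refine hK.induction_on (p := fun s => ∀ᶠ k in atTop, ∀ x ∈ s, F k x < c) (by simp)
    (fun s t hst ht => ht.mono fun k hk x hx => hk x (hst hx))
    (fun s t hs ht => (hs.and ht).mono fun k hk x hx => hx.elim (hk.1 x) (hk.2 x))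
    fun x hx => ?_
  obtain ⟨U, hU, hk⟩ := h.exists_nhds (hc x hx)
  exact ⟨U, mem_nhdsWithin_of_mem_nhds hU, hk⟩

/-- Convergence of the log-concave projections in exponentially weighted `L¹` along a weakly
convergent sequence of measures under which the log-likelihood of the limit converges. -/
theorem tendsto_weighted_logConcaveProj {d : ℕ} (hd : 1 ≤ d) {Q : ℕ → ProbabilityMeasure (Eucl d)}
    {P : ProbabilityMeasure (Eucl d)} (hP : InClassP (P : Measure (Eucl d)))
    (hQP : ∀ k, InClassP (Q k : Measure (Eucl d))) (hQ : Tendsto Q atTop (𝓝 P))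
    (hval : ∀ c : ℝ, (c : EReal) < extIntegral (logFun (logConcaveProj (P : Measure (Eucl d)))) P →
      ∀ᶠ k in atTop,
        (c : EReal) ≤ extIntegral (logFun (logConcaveProj (P : Measure (Eucl d)))) (Q k))
    {α₀ β₀ α : ℝ} (hα₀ : 0 < α₀) (hα : α < α₀)
    (hbound : ∀ x, logConcaveProj (P : Measure (Eucl d)) x ≤ Real.exp (-α₀ * ‖x‖ + β₀)) :
    Tendsto (fun k => ∫⁻ x : Eucl d, ENNReal.ofReal (Real.exp (α * ‖x‖) *
      |logConcaveProj (Q k : Measure (Eucl d)) x - logConcaveProj (P : Measure (Eucl d)) x|))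
      atTop (𝓝 0) := by
  have hmaxP := hP.isMaximiser_logConcaveProj hd
  set p := logConcaveProj (P : Measure (Eucl d)) with hp
  refine tendsto_of_subseq_tendsto fun ns hns => ?_
  have hmaxF : ∀ k, IsMaximiser (Q (ns k) : Measure (Eucl d))
      (logConcaveProj (Q (ns k) : Measure (Eucl d))) :=
    fun k => (hQP (ns k)).isMaximiser_logConcaveProj hd
  set F : ℕ → Eucl d → ℝ := fun k => logConcaveProj (Q (ns k) : Measure (Eucl d)) with hF
  have hvalF : ∀ c : ℝ, (c : EReal) < extIntegral (logFun p) P → ∀ᶠ k in atTop,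
      (c : EReal) ≤ extIntegral (logFun (F k)) (Q (ns k)) := fun c hc =>
    (hns.eventually (hval c hc)).mono fun k hk => hk.trans ((hmaxF k).2 p hmaxP.1)
  obtain ⟨g, hg, c₀, hc₀⟩ := hP.exists_density
  have hc₀p : ((c₀ - 1 : ℝ) : EReal) < extIntegral (logFun p) P :=
    lt_of_lt_of_le (EReal.coe_lt_coe_iff.2 (by linarith)) (hc₀.trans (hmaxP.2 g hg))
  obtain ⟨φ, hφ, f, hf, hlim, ⟨x₀, t, M, hMt⟩, hmax⟩ := exists_subseq_density hd hP
    (hQ.comp hns) (fun k => (hmaxF k).1) (hvalF _ hc₀p)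
  have hpf : extIntegral (logFun p) P ≤ extIntegral (logFun f) P :=
    EReal.ge_of_forall_gt_iff_ge.1 fun r hr =>
      hmax r (hφ.tendsto_atTop.eventually (hvalF r hr))
  obtain rfl : f = p := hP.isMaximiser_unique hd
    ⟨hf, fun h hh => (hmaxP.2 h hh).trans hpf⟩ hmaxP
  refine ⟨φ, ?_⟩
  -- A decay rate strictly between `α` and `α₀`, kept positive even when `α` is not, so that `s ≥
  -- 0`.
  set α' := max ((α + α₀) / 2) (α₀ / 2) with hα'
  have hαα' : α < α' := lt_max_of_lt_left (by linarith)
  have hα'0 : 0 < α' := lt_max_of_lt_right (by linarith)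
  have hα'α₀ : α' < α₀ := max_lt (by linarith) (by linarith)
  -- With `s = α₀ * R + κ`, the bound on the limit over the sphere of radius `R` is `exp (t - s -
  -- 1)`, strictly below `exp (t - s)`. The resulting slope `s / R = α₀ + κ / R` is at least `α'`
  -- once `R` is large.
  set κ := t - β₀ - 1 - α₀ * ‖x₀‖ with hκ
  set R := max 1 (|κ| / (α₀ - α')) with hR
  have hRpos : 0 < R := lt_max_of_lt_left one_pos
  set s := α₀ * R + κ with hs
  have hsR : α' * R ≤ s := by
    have h1 : |κ| ≤ R * (α₀ - α') := by
      rw [← div_le_iff₀ (by linarith)]; exact le_max_right _ _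
    have := neg_abs_le κ
    rw [hs]; nlinarith
  have hs0 : 0 ≤ s := le_trans (by positivity) hsR
  have hsphere : ∀ᶠ k in atTop, ∀ w ∈ Metric.sphere x₀ R, F (φ k) w < Real.exp (t - s) := by
    refine hlim.eventually_forall_lt_of_isCompact (isCompact_sphere x₀ R) fun w hw => ?_
    refine (hbound w).trans_lt (Real.exp_lt_exp.2 ?_)
    have h1 : R - ‖x₀‖ ≤ ‖w‖ := by
      rw [← mem_sphere_iff_norm.1 hw]
      linarith [norm_sub_le w x₀]
    have h2 := mul_le_mul_of_nonneg_left h1 hα₀.le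
    rw [hs, hκ]
    linarith
  set a := max t (M + s) + s / R * ‖x₀‖ with ha
  have hdom : ∀ᶠ k in atTop, ∀ x, F (φ k) x ≤ Real.exp (a - α' * ‖x‖) := by
    filter_upwards [hsphere] with k hk x
    have h1 := (hmaxF (φ k)).1.logConcave.le_exp_sub_norm (hmaxF (φ k)).1.nonneg hRpos hs0
      (hMt k).1 (fun w hw => (hk w (mem_sphere_iff_norm.2 hw)).le) (hMt k).2 x
    refine h1.trans (Real.exp_le_exp.2 ?_)
    have h2 : α' ≤ s / R := (le_div_iff₀ hRpos).2 hsR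
    have h3 := mul_le_mul_of_nonneg_right h2 (norm_nonneg x)
    linarith
  have hae := hlim.ae_tendsto hd hf.nonneg (fun k => (hmaxF (φ k)).1.nonneg) hf.logConcave
    fun k => (hmaxF (φ k)).1.logConcave
  have hconv := tendsto_lintegral_filter_of_dominated_convergence (μ := (volume : Measure (Eucl d)))
    (l := atTop) (F := fun k x => ENNReal.ofReal (Real.exp (α * ‖x‖) * |F (φ k) x - p x|))
    (f := fun _ => 0)
    (fun x => ENNReal.ofReal (Real.exp (a - (α' - α) * ‖x‖)) +
      ENNReal.ofReal (Real.exp (β₀ - (α₀ - α) * ‖x‖)))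
    (Eventually.of_forall fun k => by
      exact ((Measurable.mul (f := fun x : Eucl d => Real.exp (α * ‖x‖)) (by fun_prop)
        (((hmaxF (φ k)).1.measurable.sub hf.measurable).abs)).ennreal_ofReal))
    (hdom.mono fun k hk => Eventually.of_forall fun x => by
      rw [← ENNReal.ofReal_add (Real.exp_pos _).le (Real.exp_pos _).le]
      refine ENNReal.ofReal_le_ofReal ?_
      have h1 : |F (φ k) x - p x| ≤ Real.exp (a - α' * ‖x‖) + Real.exp (-α₀ * ‖x‖ + β₀) := by
        have h2 := hk x
        have h3 := hbound x
        have h4 := (hmaxF (φ k)).1.nonneg x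
        have h5 := hf.nonneg x
        rw [abs_le]
        constructor <;> linarith [Real.exp_pos (a - α' * ‖x‖), Real.exp_pos (-α₀ * ‖x‖ + β₀)]
      refine (mul_le_mul_of_nonneg_left h1 (Real.exp_pos _).le).trans (le_of_eq ?_)
      rw [mul_add, ← Real.exp_add, ← Real.exp_add]
      congr 2 <;> ring)
    (by
      rw [lintegral_add_left (by fun_prop)]
      exact (ENNReal.add_lt_top.2 ⟨lintegral_exp_sub_norm_lt_top _ (by linarith),
        lintegral_exp_sub_norm_lt_top _ (by linarith)⟩).ne)
    (hae.mono fun x hx => by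
      have h1 : Tendsto (fun k => Real.exp (α * ‖x‖) * |F (φ k) x - p x|) atTop (𝓝 0) := by
        simpa using ((hx.sub_const (p x)).abs).const_mul (Real.exp (α * ‖x‖))
      simpa [Function.comp_def] using (ENNReal.continuous_ofReal.tendsto 0).comp h1)
  simpa using hconv

/-! ### Empirical measures -/

/-- A probability measure with finite first moment that charges sets as in
`InClassP.exists_finset` belongs to the class `𝓟_d`. -/
theorem inClassP_of_forall_pos {d : ℕ} {s : Finset (Set (Eucl d))} {x₀ : Eucl d} {ρ : ℝ}
    (hρ : 0 < ρ)
    (hs : ∀ C : Set (Eucl d), Convex ℝ C → (∀ A ∈ s, (C ∩ A).Nonempty) → Metric.ball x₀ ρ ⊆ C)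
    {Q : Measure (Eucl d)} [IsProbabilityMeasure Q] (hQ : ∫⁻ x, ENNReal.ofReal ‖x‖ ∂Q < ⊤)
    (hpos : ∀ A ∈ s, 0 < Q A) : InClassP Q := by
  refine ⟨inferInstance, hQ, fun v hv c => lt_of_le_of_ne prob_le_one fun h1 => ?_⟩
  have hmeas : MeasurableSet {x : Eucl d | inner ℝ v x = c} :=
    measurableSet_eq_fun (by fun_prop) measurable_const
  have hnull := (prob_compl_eq_zero_iff hmeas).2 h1
  have hconv : Convex ℝ {x : Eucl d | inner ℝ v x = c} := by
    intro x hx y hy a b _ _ hab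
    have hx : inner ℝ v x = c := hx
    have hy : inner ℝ v y = c := hy
    change inner ℝ v (a • x + b • y) = c
    rw [inner_add_right, real_inner_smul_right, real_inner_smul_right, hx, hy, ← add_mul, hab,
      one_mul]
  -- A hyperplane of full mass meets every set of `s`, so it would contain a ball; moving along the
  -- normal `v` refutes this.
  have hball := hs _ hconv fun A hA => by
    by_contra hne
    exact (hpos A hA).ne' (measure_mono_null (fun y hy hy' => hne ⟨y, hy', hy⟩) hnull)
  have hvn : 0 < ‖v‖ := norm_pos_iff.2 hv
  have h2 : inner ℝ v x₀ = c := hball (Metric.mem_ball_self hρ)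
  have h3 : inner ℝ v (x₀ + (ρ / (2 * ‖v‖)) • v) = c := hball (by
    rw [mem_ball_iff_norm, add_sub_cancel_left, norm_smul, Real.norm_of_nonneg (by positivity)]
    field_simp
    linarith)
  rw [inner_add_right, h2, real_inner_smul_right, real_inner_self_eq_norm_sq] at h3
  have : 0 < ρ / (2 * ‖v‖) * ‖v‖ ^ 2 := by positivity
  linarith

section empirical

variable {d : ℕ}

/-- The index is shifted because `empirical x 0` is the zero measure. -/
theorem isProbabilityMeasure_empirical (x : ℕ → Eucl d) (n : ℕ) :
    IsProbabilityMeasure (empirical x (n + 1)) := by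
  constructor
  simp only [empirical, Measure.smul_apply, Measure.finsetSum_apply, measure_univ,
    Finset.sum_const, Finset.card_range, nsmul_eq_mul, mul_one, smul_eq_mul]
  exact ENNReal.inv_mul_cancel (by simp) (ENNReal.natCast_ne_top _)

theorem lintegral_empirical (x : ℕ → Eucl d) (n : ℕ) (g : Eucl d → ENNReal) :
    ∫⁻ y, g y ∂empirical x n = (n : ENNReal)⁻¹ * ∑ i ∈ Finset.range n, g (x i) := by
  simp only [empirical, lintegral_smul_measure, lintegral_finsetSum_measure, lintegral_dirac,
    smul_eq_mul]

variable {Ω : Type*} [MeasurableSpace Ω] {μ : Measure Ω} {P : Measure (Eucl d)} {X : ℕ → Ω → Eucl d}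

/-- The strong law of large numbers for nonnegative integrands. -/
theorem ae_tendsto_lintegral_empirical (hX : ∀ i, Measurable (X i)) (hindep : iIndepFun X μ)
    (hlaw : ∀ i, μ.map (X i) = P) {g : Eucl d → ENNReal} (hg : Measurable g)
    (hgP : ∫⁻ x, g x ∂P ≠ ⊤) :
    ∀ᵐ ω ∂μ, Tendsto (fun n => ∫⁻ x, g x ∂empirical (fun i => X i ω) n) atTop
      (𝓝 (∫⁻ x, g x ∂P)) := by
  have hmap : ∀ i, ∫⁻ ω, g (X i ω) ∂μ = ∫⁻ x, g x ∂P := fun i => by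
    rw [← hlaw i, lintegral_map hg (hX i)]
  have hfin : ∀ᵐ ω ∂μ, ∀ i, g (X i ω) < ⊤ := ae_all_iff.2 fun i =>
    ae_lt_top (hg.comp (hX i)) (by rw [hmap]; exact hgP)
  have hgr : Measurable fun x => (g x).toReal := hg.ennreal_toReal
  have hslln := strong_law_ae_real (μ := μ) (fun i ω => (g (X i ω)).toReal)
    (integrable_toReal_of_lintegral_ne_top (hg.comp (hX 0)).aemeasurable (by
      rw [hmap]; exact hgP))
    (fun i j hij => ((hindep.comp (fun _ x => (g x).toReal) fun _ => hgr).indepFun hij))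
    (fun i => IdentDistrib.comp (u := fun x => (g x).toReal)
      ⟨(hX i).aemeasurable, (hX 0).aemeasurable, by rw [hlaw, hlaw]⟩ hgr)
  filter_upwards [hslln, hfin] with ω hω hfinω
  rw [integral_toReal (f := fun ω => g (X 0 ω)) (hg.comp (hX 0)).aemeasurable (hfin.mono fun ω h => h 0), hmap] at hω
  have h1 := (ENNReal.continuous_ofReal.tendsto _).comp hω
  rw [ENNReal.ofReal_toReal hgP] at h1
  refine h1.congr' ?_
  filter_upwards [eventually_gt_atTop 0] with n hn
  rw [lintegral_empirical, Function.comp, ENNReal.ofReal_div_of_pos (by exact_mod_cast hn),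
    ENNReal.ofReal_sum_of_nonneg fun _ _ => ENNReal.toReal_nonneg, ENNReal.ofReal_natCast,
    ENNReal.div_eq_inv_mul]
  congr 1
  exact Finset.sum_congr rfl fun i _ => ENNReal.ofReal_toReal (hfinω i).ne

/-- Empirical measures converge weakly almost surely. -/
theorem ae_tendsto_empirical (Q : ProbabilityMeasure (Eucl d)) (hX : ∀ i, Measurable (X i))
    (hindep : iIndepFun X μ) (hlaw : ∀ i, μ.map (X i) = Q) :
    ∀ᵐ ω ∂μ, Tendsto (β := ProbabilityMeasure (Eucl d))
      (fun n => ⟨empirical (fun i => X i ω) (n + 1), isProbabilityMeasure_empirical _ n⟩) atTop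
      (𝓝 Q) := by
  let b := TopologicalSpace.countableBasis (Eucl d)
  have hb : TopologicalSpace.IsTopologicalBasis b :=
    TopologicalSpace.isBasis_countableBasis (Eucl d)
  -- A countable π-system containing a basis: one null set serves all its members, and convergence
  -- on them determines weak convergence.
  let S : Set (Set (Eucl d)) := Set.sInter '' {t | t.Finite ∧ t ⊆ b}
  have hSc : S.Countable := (Set.countable_ofPred_finite_subset
    (TopologicalSpace.countable_countableBasis (Eucl d))).image _
  have hSm : ∀ s ∈ S, MeasurableSet s := by
    rintro _ ⟨t, ⟨ht, htb⟩, rfl⟩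
    exact (ht.isOpen_sInter fun s hs => hb.isOpen (htb hs)).measurableSet
  have hSpi : IsPiSystem S := by
    rintro _ ⟨t, ⟨ht, htb⟩, rfl⟩ _ ⟨u, ⟨hu, hub⟩, rfl⟩ -
    exact ⟨t ∪ u, ⟨ht.union hu, Set.union_subset htb hub⟩, Set.sInter_union t u⟩
  have hbS : ∀ s ∈ b, s ∈ S := fun s hs =>
    ⟨{s}, ⟨Set.finite_singleton s, Set.singleton_subset_iff.2 hs⟩, Set.sInter_singleton s⟩
  have hae : ∀ᵐ ω ∂μ, ∀ s ∈ S, Tendsto (fun n => empirical (fun i => X i ω) n s) atTop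
      (𝓝 ((Q : Measure (Eucl d)) s)) := by
    rw [ae_ball_iff hSc]
    intro s hs
    have h := ae_tendsto_lintegral_empirical hX hindep hlaw
      (g := s.indicator 1) (measurable_one.indicator (hSm s hs)) (by
        rw [lintegral_indicator_one (hSm s hs)]; exact measure_ne_top _ _)
    simpa only [lintegral_indicator_one (hSm s hs)] using h
  filter_upwards [hae] with ω hω
  refine hSpi.tendsto_probabilityMeasure_of_tendsto_of_mem hSm (fun u hu x hx => ?_)
    fun s hs => ?_
  · obtain ⟨v, hv, hxv, hvu⟩ := hb.exists_subset_of_mem_open hx hu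
    exact ⟨v, hbS v hv, (hb.isOpen hv).mem_nhds hxv, hvu⟩
  · exact (ENNReal.tendsto_toNNReal (measure_ne_top _ _)).comp
      ((tendsto_add_atTop_iff_nat 1).2 (hω s hs))

/-- The log-likelihood under the empirical measures of a fixed density is almost surely eventually
above any number below its value under the law of the sample. -/
theorem ae_eventually_le_extIntegral_empirical (Q : ProbabilityMeasure (Eucl d))
    (hX : ∀ i, Measurable (X i))
    (hindep : iIndepFun X μ) (hlaw : ∀ i, μ.map (X i) = Q) {f : Eucl d → ℝ}
    (hf : IsLogConcaveDensity f) :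
    ∀ᵐ ω ∂μ, ∀ c : ℝ, (c : EReal) < extIntegral (logFun f) Q → ∀ᶠ n in atTop,
      (c : EReal) ≤ extIntegral (logFun f) (empirical (fun i => X i ω) (n + 1)) := by
  obtain ⟨M, hM⟩ := hf.exists_le_exp
  by_cases htop : ∫⁻ x, cost M (f x) ∂(Q : Measure (Eucl d)) = ⊤
  -- Here the likelihood under `Q` is `⊥`, so no real `c` lies below it.
  · refine Eventually.of_forall fun ω c hc => ?_
    rw [extIntegral_logFun_eq _ hf.measurable hM, htop] at hc
    simp at hc
  filter_upwards [ae_tendsto_lintegral_empirical hX hindep hlaw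
    ((measurable_cost M).comp hf.measurable) htop] with ω hω c hc
  obtain ⟨r, hcr, hr⟩ := EReal.lt_iff_exists_real_btwn.1 hc
  obtain ⟨hrM, hrI⟩ := (le_extIntegral_iff _ hf.measurable hM).1 hr.le
  have hcr' : c < r := EReal.coe_lt_coe_iff.1 hcr
  have hlt : ∫⁻ x, cost M (f x) ∂(Q : Measure (Eucl d)) < ENNReal.ofReal (M - c) :=
    hrI.trans_lt ((ENNReal.ofReal_lt_ofReal_iff (by linarith)).2 (by linarith))
  filter_upwards [((tendsto_add_atTop_iff_nat 1).2 hω).eventually_lt_const hlt] with n hn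
  have := isProbabilityMeasure_empirical (fun i => X i ω) n
  exact (le_extIntegral_iff _ hf.measurable hM).2 ⟨by linarith, hn.le⟩

end empirical

end LogConcaveMLE

/-! ### The main theorem -/

theorem mainTheorem4 {d : ℕ} (hd : 1 ≤ d)
    {Ω : Type*} [MeasurableSpace Ω] (μ : Measure Ω) [IsProbabilityMeasure μ]
    (P : Measure (EuclideanSpace ℝ (Fin d))) (hP : LogConcaveMLE.InClassP P)
    (X : ℕ → Ω → EuclideanSpace ℝ (Fin d))
    (hX : ∀ i, Measurable (X i)) (hindep : iIndepFun X μ) (hlaw : ∀ i, μ.map (X i) = P) :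
    LogConcaveMLE.ProjWellDefined P ∧
    (∃ α₀ : ℝ, 0 < α₀ ∧ ∃ β₀ : ℝ, ∀ x : EuclideanSpace ℝ (Fin d),
      LogConcaveMLE.logConcaveProj P x ≤ Real.exp (-α₀ * ‖x‖ + β₀)) ∧
    ∀ᵐ ω ∂μ,
      (∀ᶠ n in atTop,
        LogConcaveMLE.ProjWellDefined (LogConcaveMLE.empirical (fun i => X i ω) n)) ∧
      ∀ α₀ : ℝ, 0 < α₀ → ∀ β₀ : ℝ,
        (∀ x : EuclideanSpace ℝ (Fin d),
          LogConcaveMLE.logConcaveProj P x ≤ Real.exp (-α₀ * ‖x‖ + β₀)) →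
        ∀ α : ℝ, α < α₀ →
          Tendsto (fun n : ℕ => ∫⁻ x : EuclideanSpace ℝ (Fin d), ENNReal.ofReal
              (Real.exp (α * ‖x‖) *
                |LogConcaveMLE.logConcaveProj (LogConcaveMLE.empirical (fun i => X i ω) n) x
                  - LogConcaveMLE.logConcaveProj P x|))
            atTop (𝓝 0) := by
  have hmax := hP.isMaximiser_logConcaveProj hd
  refine ⟨hP.projWellDefined hd, ?_, ?_⟩
  · obtain ⟨a, b, hb, h⟩ := hmax.1.exists_envelope
    exact ⟨b, hb, a, fun x => (h x).trans (Real.exp_le_exp.2 (by linarith))⟩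
  let Q : ProbabilityMeasure (EuclideanSpace ℝ (Fin d)) := ⟨P, hP.isProbabilityMeasure⟩
  obtain ⟨s, x₀, ρ, hρ, hs, hball⟩ := hP.exists_finset hd
  -- Neither event involves `α₀`, `β₀` or `α`, so one null set serves all of them.
  filter_upwards [LogConcaveMLE.ae_tendsto_empirical Q hX hindep hlaw,
    LogConcaveMLE.ae_eventually_le_extIntegral_empirical Q hX hindep hlaw hmax.1]
    with ω hweak hval
  have hclass : ∀ᶠ n in atTop,
      LogConcaveMLE.InClassP (LogConcaveMLE.empirical (fun i => X i ω) (n + 1)) := by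
    have hpos : ∀ᶠ n in atTop, ∀ A ∈ s,
        0 < LogConcaveMLE.empirical (fun i => X i ω) (n + 1) A := by
      rw [Filter.eventually_all_finset]
      intro A hA
      exact eventually_lt_of_lt_liminf ((hs A hA).2.trans_le
        (ProbabilityMeasure.le_liminf_measure_open_of_tendsto hweak (hs A hA).1))
    filter_upwards [hpos] with n hn
    have := LogConcaveMLE.isProbabilityMeasure_empirical (fun i => X i ω) n
    refine LogConcaveMLE.inClassP_of_forall_pos hρ hball ?_ hn
    rw [LogConcaveMLE.lintegral_empirical]
    exact ENNReal.mul_lt_top (by simp) (ENNReal.sum_lt_top.2 fun i _ => ENNReal.ofReal_lt_top)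
  obtain ⟨N, hN⟩ := eventually_atTop.1 hclass
  refine ⟨?_, fun α₀ hα₀ β₀ hbound α hα => ?_⟩
  · filter_upwards [eventually_ge_atTop (N + 1)] with n hn
    obtain ⟨m, rfl⟩ := Nat.exists_eq_add_of_le' (le_of_add_le_right hn)
    exact (hN m (by omega)).projWellDefined hd
  -- Dropping the first terms puts every measure of the sequence in the class, as the stability
  -- result requires.
  · rw [← tendsto_add_atTop_iff_nat (N + 1)]
    exact LogConcaveMLE.tendsto_weighted_logConcaveProj hd (P := Q)
      (Q := fun n => ⟨LogConcaveMLE.empirical (fun i => X i ω) (n + N + 1),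
        LogConcaveMLE.isProbabilityMeasure_empirical _ _⟩) hP (fun k => hN _ (by omega))
      (hweak.comp (tendsto_add_atTop_nat N))
      (fun c hc => (tendsto_add_atTop_nat N).eventually (hval c hc)) hα₀ hα hbound
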